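/- **Setting.** Let $n\ge 1$. A clustering of $\{1,\dots,n\}$ into $K$ communities is a surjective map $c:\{1,\dots,n\}\to\{1,\dots,K\}$; write $\mathcal N_k=c^{-1}(k)$, $n_k=|\mathcal N_k|\ge 1$. For an $n\times n$ matrix $B$ let $B^{(k,l)}$ be its block with rows in $\mathcal N_k$ and columns in $\mathcal N_l$. For $J\subseteq\{1,\dots,n\}\times\{1,\dots,K\}$ put $J_{k,l}=\{i\in\mathcal N_k:(i,l)\in J\}$, so that $|J|=\sum_{k,l}|J_{k,l}|$. *Model.* Let $c_*$ be a clustering into $K_*$ communities and $\Lambda_*\in[0,1]^{n\times K_*}$. Let $(P_*)_{i,j}=(\Lambda_*)_{i,c_*(j)}(\Lambda_*)_{j,c_*(i)}$ (so each block $P_*^{(k,l)}=\Lambda_*^{(k,l)}[\Lambda_*^{(l,k)}]^T$ has rank at most one), and $J_*=\{(i,l):(\Lambda_*)_{i,l}\ne 0\}$. The random matrix $A\in\{0,1\}^{n\times n}$ is symmetric and $A_{i,j}$, $1\le i\le j\le n$, are independent Bernoulli variables with means $(P_*)_{i,j}$. *Penalties.* With the convention $0\ln(\cdot/0)=0$,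 for $\beta_1,\beta_2>0$ let $$\mathrm{Pen}^{(s)}(n,J,K)=\beta_1\sum_{k,l=1}^K|J_{k,l}|\ln\frac{n_ke}{|J_{k,l}|}+\beta_2K\sum_{k=1}^K\ln n_k+\beta_2[n\ln K+\ln n],$$ $$\mathrm{Pen}^{(ns)}(n,J,K)=\beta_1|J|\ln\frac{nKe}{|J|}+2\beta_2\ln n+\beta_2[n\ln K+\ln n].$$ *Estimator.* Let $\mathrm{Pen}$ be either of the two penalties, and let $(\hat\Theta,\hat c,\hat J,\hat K)$ minimize $$\sum_{k,l=1}^K\|A^{(k,l)}-\Theta^{(k,l)}\|_F^2+\mathrm{Pen}(n,J,K)$$ over all $K$, all clusterings $c$ into $K$ communities, all $J\subseteq\{1,\dots,n\}\times\{1,\dots,K\}$ and all block matrices $\Theta$ with $\mathrm{supp}(\Theta^{(k,l)})=J_{k,l}\times J_{l,k}$ and $\mathrm{rank}(\Theta^{(k,l)})\le 1$ (i.e. rank one unless the support is empty). Let $\hat P$ be $\hat\Theta$ with rows and columns put back in the original order of the nodes. **Theorem.** There are absolute constants $C_1,C_2>0$ such that the following holds for all $\alpha_1,\alpha_2>0$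 with $\alpha_1+8\alpha_2<1$. Put $$\beta_1=\frac{2(C_1+C_2)(1+\alpha_2)}{\alpha_2}+\frac2{\alpha_1},\quad \beta_2=\frac{2C_2(1+\alpha_2)}{\alpha_2}+\frac2{\alpha_1},\quad H_0=\frac1{1-\alpha_1-8\alpha_2},\quad \tilde C=2H_0\Big(C_2+\frac1{\alpha_1}+\frac{C_2}{\alpha_2}\Big).$$ 1. For either penalty, every $n$, every model as above and every such estimator $\hat P$, for every $t>0$, $$\mathbb P\Big\{n^{-2}\|\hat P-P_*\|_F^2\le n^{-2}H_0\,\mathrm{Pen}(n,J_*,K_*)+n^{-2}\tilde C\,t\Big\}\ge 1-3e^{-t},$$ and $\|\hat P-P_*\|_F^2$ is integrable with $$n^{-2}\,\mathbb E\|\hat P-P_*\|_F^2\le n^{-2}H_0\,\mathrm{Pen}(n,J_*,K_*)+3n^{-2}\tilde C.$$ 2. There is $\kappa>0$, depending only on $C_1,C_2,\alpha_1,\alpha_2$, such that for all $n\ge1$, all clusterings into $K$ communities and all $J$, with $R(n,J,K)=n\ln K+|J|\ln(nKe/|J|)+\ln n$, $$\kappa^{-1}R(n,J,K)\le\mathrm{Pen}^{(ns)}(n,J,K)\le\kappa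 R(n,J,K),$$ and $\mathrm{Pen}^{(s)}(n,J,K)\le\kappa R(n,J,K)$ if moreover $n\ge 8$ and $K\le\sqrt{n/\ln n}$. -/

import Mathlib

open MeasureTheory ProbabilityTheory

namespace SPABM

noncomputable section

/-! ### Community assignments, rearranged matrices and blocks

A clustering of `n` nodes into `K` communities is a map `c : Fin n → Fin K` (the membership matrix
has `Z i k = 1` iff `c i = k`); surjectivity of `c` says that no community is empty. -/

/-- The nodes of community `k`. -/
abbrev Community {n K : ℕ} (c : Fin n → Fin K) (k : Fin K) : Type := {i : Fin n // c i = k}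

/-- The size `n_k` of community `k`. -/
def commSize {n K : ℕ} (c : Fin n → Fin K) (k : Fin K) : ℕ := Fintype.card (Community c k)

/-- Node positions listed community after community. -/
abbrev Rearranged {n K : ℕ} (c : Fin n → Fin K) : Type := Σ k : Fin K, Community c k

/-- The permutation that matches the rearranged positions with the original nodes. -/
def perm {n K : ℕ} (c : Fin n → Fin K) : Rearranged c ≃ Fin n := Equiv.sigmaFiberEquiv c

/-- The rearranged version `B(Z,K)` of `B`. -/
def rearrange {n K : ℕ} (c : Fin n → Fin K) (B : Matrix (Fin n) (Fin n) ℝ) :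
    Matrix (Rearranged c) (Rearranged c) ℝ :=
  B.submatrix (perm c) (perm c)

/-- The inverse of `rearrange`: back to the original order of the nodes. -/
def restore {n K : ℕ} (c : Fin n → Fin K) (M : Matrix (Rearranged c) (Rearranged c) ℝ) :
    Matrix (Fin n) (Fin n) ℝ :=
  M.submatrix (perm c).symm (perm c).symm

/-- The `(k,l)`-th block of a rearranged matrix. -/
def block {n K : ℕ} {c : Fin n → Fin K} (M : Matrix (Rearranged c) (Rearranged c) ℝ)
    (k l : Fin K) : Matrix (Community c k) (Community c l) ℝ :=
  M.submatrix (Sigma.mk k) (Sigma.mk l)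

/-- The squared Frobenius norm. -/
def frobSq {m m' : Type} [Fintype m] [Fintype m'] (M : Matrix m m' ℝ) : ℝ :=
  ∑ i, ∑ j, M i j ^ 2

/-- A sparsity set is a set `J` of positions of an `n × K` matrix; `J_{k,l}` consists of
the nodes `i` of community `k` with `(i, l) ∈ J`, so that `|J| = ∑ |J_{k,l}|`. -/
def suppSet {n K : ℕ} (c : Fin n → Fin K) (J : Finset (Fin n × Fin K)) (k l : Fin K) :
    Finset (Community c k) :=
  Finset.univ.filter fun i => (i.1, l) ∈ J

/-! ### The model -/

/-- The matrix of connection probabilities: `P^{(k,l)} = Λ^{(k,l)} (Λ^{(l,k)})ᵀ`, where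
`Λ^{(k,l)}` is the part of column `l` of `Λ` that belongs to the nodes of community `k`. -/
def probMatrix {n K : ℕ} (c : Fin n → Fin K) (Lam : Matrix (Fin n) (Fin K) ℝ) :
    Matrix (Fin n) (Fin n) ℝ :=
  Matrix.of fun i j => Lam i (c j) * Lam j (c i)

/-- The positions of the nonzero entries of `Λ`. -/
def trueSupp {n K : ℕ} (Lam : Matrix (Fin n) (Fin K) ℝ) : Finset (Fin n × Fin K) :=
  Finset.univ.filter fun p => Lam p.1 p.2 ≠ 0

/-- `A` is a random symmetric `0`-`1` matrix whose entries with `i ≤ j` are independent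
Bernoulli variables with means `P i j`. -/
structure IsBernoulliNetwork {n : ℕ} {Ω : Type*} [MeasurableSpace Ω] (μ : Measure Ω)
    (A : Ω → Matrix (Fin n) (Fin n) ℝ) (P : Matrix (Fin n) (Fin n) ℝ) : Prop where
  measurable : ∀ i j, Measurable fun ω => A ω i j
  zero_or_one : ∀ ω i j, A ω i j = 0 ∨ A ω i j = 1
  symm : ∀ ω i j, A ω i j = A ω j i
  prob : ∀ i j, i ≤ j → μ.real {ω | A ω i j = 1} = P i j
  indep : iIndepFun (fun (p : {p : Fin n × Fin n // p.1 ≤ p.2}) ω => A ω p.1.1 p.1.2) μ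

/-! ### The penalties -/

inductive PenaltyKind : Type
  | separable
  | nonseparable

/-- `Pen^{(0,s)}`; a summand with `|J_{k,l}| = 0` is zero. -/
def penZeroSep (β₁ β₂ : ℝ) {n K : ℕ} (c : Fin n → Fin K) (J : Finset (Fin n × Fin K)) : ℝ :=
  β₁ * ∑ k, ∑ l, ((suppSet c J k l).card : ℝ) *
      Real.log ((commSize c k : ℝ) * Real.exp 1 / ((suppSet c J k l).card : ℝ))
    + β₂ * (K : ℝ) * ∑ k, Real.log (commSize c k : ℝ)

/-- `Pen^{(0,ns)}`; the first term is zero if `|J| = 0`. -/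
def penZeroNonsep (β₁ β₂ : ℝ) {n K : ℕ} (J : Finset (Fin n × Fin K)) : ℝ :=
  β₁ * ((J.card : ℝ) * Real.log ((n : ℝ) * (K : ℝ) * Real.exp 1 / (J.card : ℝ)))
    + 2 * β₂ * Real.log (n : ℝ)

/-- `Pen^{(1)}`. -/
def penOne (β₂ : ℝ) (n K : ℕ) : ℝ :=
  β₂ * ((n : ℝ) * Real.log (K : ℝ) + Real.log (n : ℝ))

/-- The total penalty. -/
def pen (a : PenaltyKind) (β₁ β₂ : ℝ) {n K : ℕ} (c : Fin n → Fin K)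
    (J : Finset (Fin n × Fin K)) : ℝ :=
  match a with
  | .separable => penZeroSep β₁ β₂ c J + penOne β₂ n K
  | .nonseparable => penZeroNonsep β₁ β₂ J + penOne β₂ n K

/-- The rate `n ln K + |J| ln (n K e / |J|) + ln n`. -/
def rate {n K : ℕ} (J : Finset (Fin n × Fin K)) : ℝ :=
  (n : ℝ) * Real.log (K : ℝ)
    + (J.card : ℝ) * Real.log ((n : ℝ) * (K : ℝ) * Real.exp 1 / (J.card : ℝ))
    + Real.log (n : ℝ)

/-! ### The optimization problem -/

/-- The feasible points `(Θ, Z, J, K)`. A block whose support `J_{k,l} × J_{l,k}` is empty is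
zero; all other blocks have rank one. -/
structure Feasible (n : ℕ) where
  K : ℕ
  c : Fin n → Fin K
  surj : Function.Surjective c
  J : Finset (Fin n × Fin K)
  Theta : Matrix (Rearranged c) (Rearranged c) ℝ
  rank_le_one : ∀ k l, (block Theta k l).rank ≤ 1
  supp_eq : ∀ k l (i : Community c k) (j : Community c l),
    block Theta k l i j ≠ 0 ↔ i ∈ suppSet c J k l ∧ j ∈ suppSet c J l k

/-- The penalized least-squares criterion. -/
def objective (a : PenaltyKind) (β₁ β₂ : ℝ) {n : ℕ} (A : Matrix (Fin n) (Fin n) ℝ)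
    (s : Feasible n) : ℝ :=
  (∑ k, ∑ l, frobSq (block (rearrange s.c A) k l - block s.Theta k l)) + pen a β₁ β₂ s.c s.J

/-- `s` minimizes the criterion over all feasible points. -/
def IsSolution (a : PenaltyKind) (β₁ β₂ : ℝ) {n : ℕ} (A : Matrix (Fin n) (Fin n) ℝ)
    (s : Feasible n) : Prop :=
  ∀ s' : Feasible n, objective a β₁ β₂ A s ≤ objective a β₁ β₂ A s'

/-- The estimator `P̂`: the block matrix `Θ̂` in the original order of the nodes. -/
def Feasible.estimator {n : ℕ} (s : Feasible n) : Matrix (Fin n) (Fin n) ℝ :=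
  restore s.c s.Theta

/-! ### The constants -/

def betaOne (C₁ C₂ α₁ α₂ : ℝ) : ℝ := 2 * (C₁ + C₂) * (1 + α₂) / α₂ + 2 / α₁

def betaTwo (C₂ α₁ α₂ : ℝ) : ℝ := 2 * C₂ * (1 + α₂) / α₂ + 2 / α₁

def hZero (α₁ α₂ : ℝ) : ℝ := (1 - α₁ - 8 * α₂)⁻¹

def cTilde (C₂ α₁ α₂ : ℝ) : ℝ := 2 * hZero α₁ α₂ * (C₂ + 1 / α₁ + C₂ / α₂)

end

end SPABM

namespace SPABM

section Noise

/-! ### Hoeffding's inequality for linear functionals of the noise -/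

/-! Write T for the estimator, P for the true matrix and E = A - P. Since P is itself a feasible
point, minimality (`IsSolution.basic_inequality`) gives ‖T - P‖² + Pen(selected) ≤ 2⟨E, T - P⟩ +
Pen(true). It remains to bound the noise term, uniformly over all models, by a fraction of ‖T - P‖²
plus the penalty of the selected model, which then cancels.

For a fixed clustering and support J, the matrices with rank-one blocks supported in J have a
nearest point T₀ to P (`exists_nearest_rankOneClass`). It is not random, so ⟨E, T₀ - P⟩ obeys
Hoeffding's inequality (`IsBernoulliNetwork.tail_frobInner`). A difference of two members of the
class is a sum of two rank-one block matrices of no larger norm (`exists_split_outer`). On such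
matrices the noise is a bilinear form, controlled up to a constant by its values at no more than
e^(12|J|) pairs of lattice points (`frobInner_blockOuter_le_of_lattice`, `card_latticeNet_le`).

The penalty pays for the union bound over K, clusterings and supports. In the separable case the
weight of a support factorizes over the blocks: the sum over the subsets of one block is at most 2,
and the term K ∑ ln n_k supplies a factor 1/(n_k n_l). This suffices unless both communities are
single nodes. Single-entry blocks are therefore removed from T beforehand (`dropSingles`) and
handled deterministically through |E i j| ≤ 1, at a cost proportional to |J|, which the penalty
dominates.

The expectation follows by integrating the tail. The comparison with the rate uses a tangent to the
logarithm (`suppCost_separable_le`) and K² ln n ≤ n (`sizeCost_separable_le`). -/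

/-- The Frobenius inner product. -/
noncomputable def frobInner {n : ℕ} (E W : Matrix (Fin n) (Fin n) ℝ) : ℝ :=
  ∑ i, ∑ j, E i j * W i j

theorem frobSq_nonneg {m m' : Type} [Fintype m] [Fintype m'] (M : Matrix m m' ℝ) :
    0 ≤ frobSq M :=
  Finset.sum_nonneg fun _ _ => Finset.sum_nonneg fun _ _ => sq_nonneg _

/-- A sum over all pairs, folded onto the pairs on or above the diagonal. -/
theorem sum_sum_eq_sum_upper {n : ℕ} (f : Fin n → Fin n → ℝ) :
    ∑ i, ∑ j, f i j = ∑ p : {p : Fin n × Fin n // p.1 ≤ p.2},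
      (f p.1.1 p.1.2 + if p.1.1 < p.1.2 then f p.1.2 p.1.1 else 0) := by
  have h1 : ∑ i, ∑ j, f i j = ∑ i, ∑ j, (if i ≤ j then f i j else 0)
      + ∑ i, ∑ j, (if j < i then f i j else 0) := by
    rw [← Finset.sum_add_distrib]
    refine Finset.sum_congr rfl fun i _ => ?_
    rw [← Finset.sum_add_distrib]
    refine Finset.sum_congr rfl fun j _ => ?_
    by_cases h : i ≤ j
    · simp [h, not_lt.2 h]
    · simp [h, not_le.1 h]
  have h2 : ∑ i, ∑ j, (if j < i then f i j else 0) = ∑ i, ∑ j, (if i < j then f j i else 0) :=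
    Finset.sum_comm
  rw [h1, h2, ← Finset.sum_add_distrib]
  simp_rw [← Finset.sum_add_distrib]
  rw [← Fintype.sum_prod_type' (f := fun i j => (if i ≤ j then f i j else 0)
      + if i < j then f j i else 0),
    ← Finset.sum_subtype (Finset.univ.filter fun p : Fin n × Fin n => p.1 ≤ p.2) (by simp)
      (fun p => f p.1 p.2 + if p.1 < p.2 then f p.2 p.1 else 0), Finset.sum_filter]
  refine Finset.sum_congr rfl fun p _ => ?_
  by_cases h : p.1 ≤ p.2
  · simp [h]
  · simp [h, not_lt.2 (not_le.1 h).le]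

theorem IsBernoulliNetwork.hasSubgaussianMGF {n : ℕ} {Ω : Type*} [MeasurableSpace Ω]
    {μ : Measure Ω} [IsProbabilityMeasure μ] {A : Ω → Matrix (Fin n) (Fin n) ℝ}
    {P : Matrix (Fin n) (Fin n) ℝ} (hA : IsBernoulliNetwork μ A P) {i j : Fin n} (hij : i ≤ j) :
    HasSubgaussianMGF (fun ω => A ω i j - P i j) (1 / 4) μ := by
  have hmean : μ[fun ω => A ω i j] = P i j := by
    have : (fun ω => A ω i j) = Set.indicator {ω | A ω i j = 1} (fun _ => (1 : ℝ)) := by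
      funext ω
      rcases hA.zero_or_one ω i j with h | h <;> simp [Set.indicator, h]
    rw [this, integral_indicator_const _ (measurableSet_eq_fun (hA.measurable i j)
      measurable_const), hA.prob i j hij]
    simp
  have h := hasSubgaussianMGF_of_mem_Icc (μ := μ) (a := 0) (b := 1)
    (hA.measurable i j).aemeasurable (ae_of_all _ fun ω => by
      rcases hA.zero_or_one ω i j with h | h <;> simp [h])
  rw [hmean] at h
  convert h using 1
  ext; norm_num

/-- Every linear functional of the noise is sub-Gaussian on the scale of its Frobenius norm. -/
theorem IsBernoulliNetwork.tail_frobInner {n : ℕ} {Ω : Type*} [MeasurableSpace Ω]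
    {μ : Measure Ω} [IsProbabilityMeasure μ] {A : Ω → Matrix (Fin n) (Fin n) ℝ}
    {P : Matrix (Fin n) (Fin n) ℝ} (hA : IsBernoulliNetwork μ A P)
    (hP : ∀ i j, P i j = P j i) (W : Matrix (Fin n) (Fin n) ℝ) {x : ℝ} (hx : 0 ≤ x) :
    μ.real {ω | √(frobSq W) * √x < frobInner (A ω - P) W} ≤ Real.exp (-x) := by
  set w : {p : Fin n × Fin n // p.1 ≤ p.2} → ℝ := fun p =>
    W p.1.1 p.1.2 + if p.1.1 < p.1.2 then W p.1.2 p.1.1 else 0 with hw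
  have hsum : ∀ ω, frobInner (A ω - P) W = ∑ p, w p * (A ω p.1.1 p.1.2 - P p.1.1 p.1.2) := by
    intro ω
    rw [frobInner, sum_sum_eq_sum_upper]
    refine Finset.sum_congr rfl fun p _ => ?_
    simp only [hw, Matrix.sub_apply, hA.symm ω p.1.2 p.1.1, hP p.1.2 p.1.1]
    split_ifs <;> ring
  -- Folding off-diagonal pairs costs a factor 2 by (a + b)² ≤ 2a² + 2b². With variance proxy 1/4
  -- per entry, the Hoeffding exponent is still at least x.
  have hnorm : ∑ p, w p ^ 2 ≤ 2 * frobSq W := by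
    rw [frobSq, sum_sum_eq_sum_upper, Finset.mul_sum]
    refine Finset.sum_le_sum fun p _ => ?_
    simp only [hw]
    split_ifs
    · nlinarith [sq_nonneg (W p.1.1 p.1.2 - W p.1.2 p.1.1)]
    · nlinarith [sq_nonneg (W p.1.1 p.1.2)]
  have hind : iIndepFun (fun (p : {p : Fin n × Fin n // p.1 ≤ p.2}) ω =>
      w p * (A ω p.1.1 p.1.2 - P p.1.1 p.1.2)) μ :=
    hA.indep.comp (fun p y => w p * (y - P p.1.1 p.1.2)) fun p => by fun_prop
  have hsub : HasSubgaussianMGF (fun ω => ∑ p, w p * (A ω p.1.1 p.1.2 - P p.1.1 p.1.2))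
      (∑ p, NNReal.mk (w p ^ 2) (sq_nonneg (w p)) * (1 / 4)) μ :=
    HasSubgaussianMGF.sum_of_iIndepFun hind (s := Finset.univ)
    fun p _ => (hA.hasSubgaussianMGF p.2).const_mul (w p)
  rcases (Finset.sum_nonneg fun q (_ : q ∈ Finset.univ) => sq_nonneg (w q)).eq_or_lt
    with h0 | h0
  -- This happens for antisymmetric W, where the functional vanishes; the strict inequality makes
  -- the event empty.
  · have hw0 : ∀ p, w p = 0 := fun p => by
      simpa using (Finset.sum_eq_zero_iff_of_nonneg (fun q _ => sq_nonneg (w q))).1 h0.symm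
        p (Finset.mem_univ p)
    have : {ω | √(frobSq W) * √x < frobInner (A ω - P) W} = ∅ := by
      ext ω
      simp only [hsum, hw0, zero_mul, Finset.sum_const_zero, Set.mem_ofPred_eq,
        Set.mem_empty_iff_false, iff_false, not_lt]
      positivity
    rw [this]
    simpa using Real.exp_nonneg _
  · refine (measureReal_mono (fun ω (hω : √(frobSq W) * √x < frobInner (A ω - P) W) => ?_)).trans
      ((hsub.measure_ge_le (ε := √(frobSq W) * √x) (by positivity)).trans
        (Real.exp_le_exp.2 ?_))
    · simpa [hsum] using hω.le
    · rw [mul_pow, Real.sq_sqrt (frobSq_nonneg W), Real.sq_sqrt hx]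
      have hc : ((∑ p, NNReal.mk (w p ^ 2) (sq_nonneg (w p)) * (1 / 4) : NNReal) : ℝ)
          = (∑ p, w p ^ 2) / 4 := by
        push_cast
        rw [Finset.sum_div]
        refine Finset.sum_congr rfl fun p _ => ?_
        change w p ^ 2 * (1 / 4) = _
        ring
      rw [hc, neg_div, neg_le_neg_iff, le_div_iff₀ (by linarith)]
      nlinarith

end Noise

section Lattice

/-! ### Discretization by integer points -/

/-- Rounding a real number to an integer towards zero. -/
theorem exists_int_round (y : ℝ) : ∃ z : ℤ, (z : ℝ) ^ 2 ≤ y ^ 2 ∧ (y - z) ^ 2 ≤ 1 := by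
  rcases le_total 0 y with h | h
  · refine ⟨⌊y⌋, ?_, ?_⟩
    · have h0 : (0 : ℝ) ≤ ⌊y⌋ := by exact_mod_cast Int.floor_nonneg.2 h
      exact pow_le_pow_left₀ h0 (Int.floor_le y) 2
    · have h1 := Int.floor_le y
      have h2 := Int.lt_floor_add_one y
      nlinarith
  · refine ⟨⌈y⌉, ?_, ?_⟩
    · have h0 : (⌈y⌉ : ℝ) ≤ 0 := by
        have : ⌈y⌉ ≤ 0 := Int.ceil_le.2 (by simpa using h)
        exact_mod_cast this
      have := Int.le_ceil y
      nlinarith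
    · have h1 := Int.le_ceil y
      have h2 := Int.ceil_lt_add_one y
      nlinarith

/-- Some point of the scaled integer lattice in the unit ball attains half of the norm of `g`. -/
theorem exists_lattice_dual {ι : Type*} [DecidableEq ι] (s : Finset ι) (g : ι → ℝ) :
    ∃ z : ι → ℤ, (∀ q ∉ s, z q = 0) ∧ ∑ q ∈ s, (z q : ℝ) ^ 2 ≤ 4 * s.card ∧
      √(∑ q ∈ s, g q ^ 2) / 2 ≤ ∑ q ∈ s, g q * (z q / (2 * √s.card)) := by
  set N := √(∑ q ∈ s, g q ^ 2) with hN
  have hN2 : N ^ 2 = ∑ q ∈ s, g q ^ 2 :=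
    Real.sq_sqrt (Finset.sum_nonneg fun _ _ => sq_nonneg _)
  have hN0 : 0 ≤ N := Real.sqrt_nonneg _
  rcases hN0.eq_or_lt with h0 | h0
  · exact ⟨fun _ => 0, by simp, by simp, by simp [← h0]⟩
  have hs : 0 < (s.card : ℝ) := by
    rcases s.eq_empty_or_nonempty with rfl | h
    · simp [hN] at h0
    · exact_mod_cast h.card_pos
  set r := √(s.card : ℝ) with hr
  have hr0 : 0 < r := Real.sqrt_pos.2 hs
  have hr2 : r ^ 2 = s.card := Real.sq_sqrt hs.le
  choose f hf1 hf2 using exists_int_round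
  -- Rounding 2√|s| g/‖g‖ towards zero does not increase the norm, whence 4|s|. After rescaling,
  -- each coordinate has moved by at most 1/(2√|s|), hence the whole vector by at most 1/2.
  refine ⟨fun q => if q ∈ s then f (2 * r * (g q / N)) else 0, fun q hq => by simp [hq], ?_, ?_⟩
  · calc ∑ q ∈ s, (((if q ∈ s then f (2 * r * (g q / N)) else 0 : ℤ)) : ℝ) ^ 2
        ≤ ∑ q ∈ s, (4 * r ^ 2 / N ^ 2) * g q ^ 2 := by
          refine Finset.sum_le_sum fun q hq => ?_
          rw [if_pos hq]
          refine (hf1 _).trans (le_of_eq ?_)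
          field_simp
          ring
      _ = 4 * s.card := by
          rw [← Finset.mul_sum, ← hN2, hr2]
          field_simp
  · have key : ∀ q ∈ s, g q ^ 2 / N - (N * (1 / (4 * r ^ 2)) + g q ^ 2 / N / 4)
        ≤ g q * ((f (2 * r * (g q / N)) : ℝ) / (2 * r)) := by
      intro q _
      have hz := hf2 (2 * r * (g q / N))
      obtain ⟨v, hv⟩ : ∃ v, v = g q / N := ⟨_, rfl⟩
      have hg : g q = N * v := by rw [hv, mul_div_cancel₀ _ h0.ne']
      rw [← hv] at hz ⊢
      obtain ⟨e, he⟩ : ∃ e, e = v - (f (2 * r * v) : ℝ) / (2 * r) := ⟨_, rfl⟩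
      have he2 : e ^ 2 ≤ 1 / (4 * r ^ 2) := by
        rw [le_div_iff₀ (mul_pos four_pos (pow_pos hr0 2))]
        refine le_trans (le_of_eq ?_) hz
        have : 2 * r * e = 2 * r * v - f (2 * r * v) := by
          rw [he]; field_simp
        rw [← this]
        ring
      have hfe : (f (2 * r * v) : ℝ) / (2 * r) = v - e := by rw [he]; ring
      have h3 : g q ^ 2 / N = N * v ^ 2 := by
        rw [hg, mul_pow, pow_two N, mul_assoc, mul_div_cancel_left₀ _ h0.ne']
      rw [hfe, h3, hg]
      -- This is v e ≤ v²/4 + e². Summed over s, each of the two terms loses N/4, leaving N/2.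
      nlinarith [mul_nonneg hN0 (sq_nonneg (v / 2 - e)), mul_le_mul_of_nonneg_left he2 hN0]
    calc N / 2 = ∑ q ∈ s, (g q ^ 2 / N - (N * (1 / (4 * r ^ 2)) + g q ^ 2 / N / 4)) := by
          rw [Finset.sum_sub_distrib, Finset.sum_add_distrib, Finset.sum_const, nsmul_eq_mul,
            ← hr2, ← Finset.sum_div s (fun q => g q ^ 2 / N), ← Finset.sum_div s (fun q => g q ^ 2),
            ← hN2]
          field_simp
          ring
      _ ≤ ∑ q ∈ s, g q * ((f (2 * r * (g q / N)) : ℝ) / (2 * r)) := Finset.sum_le_sum key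
      _ = _ := Finset.sum_congr rfl fun q hq => by simp only [if_pos hq]

/-- The integer points supported in `J` with squared norm at most `4 |J|`. -/
noncomputable def latticeNet {ι : Type*} [Fintype ι] [DecidableEq ι] (J : Finset ι) :
    Finset (ι → ℤ) :=
  (Fintype.piFinset fun q => if q ∈ J then Finset.Icc (-(4 * J.card : ℤ)) (4 * J.card) else {0}).filter
    fun z => ∑ q ∈ J, (z q : ℝ) ^ 2 ≤ 4 * J.card

theorem mem_latticeNet {ι : Type*} [Fintype ι] [DecidableEq ι] {J : Finset ι} {z : ι → ℤ}
    (h0 : ∀ q ∉ J, z q = 0) (h : ∑ q ∈ J, (z q : ℝ) ^ 2 ≤ 4 * J.card) : z ∈ latticeNet J := by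
  rw [latticeNet, Finset.mem_filter, Fintype.mem_piFinset]
  refine ⟨fun q => ?_, h⟩
  by_cases hq : q ∈ J
  · rw [if_pos hq, Finset.mem_Icc, ← abs_le]
    have h1 : (z q : ℝ) ^ 2 ≤ 4 * J.card :=
      (Finset.single_le_sum (f := fun q => (z q : ℝ) ^ 2) (fun _ _ => sq_nonneg _) hq).trans h
    have h2 : z q ^ 2 ≤ 4 * J.card := by exact_mod_cast h1
    refine le_trans ?_ h2
    rw [← sq_abs]
    exact Int.le_self_sq _
  · rw [if_neg hq, Finset.mem_singleton]
    exact h0 q hq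

theorem sum_Icc_exp_neg_sq_le (B : ℕ) :
    ∑ m ∈ Finset.Icc (-(B : ℤ)) B, Real.exp (-(m : ℝ) ^ 2) ≤ 5 := by
  rw [Finset.sum_Icc_of_even_eq_range (f := fun m : ℤ => Real.exp (-(m : ℝ) ^ 2))
    (fun m => by simp)]
  have h : ∑ m ∈ Finset.range (B + 1), Real.exp (-((m : ℤ) : ℝ) ^ 2) ≤ 2 := by
    refine (Finset.sum_le_sum fun m _ => ?_).trans (sum_geometric_two_le (B + 1))
    have h2 : (2 : ℝ) ^ m ≤ Real.exp ((m : ℝ) ^ 2) := by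
      calc (2 : ℝ) ^ m ≤ Real.exp 1 ^ m :=
            pow_le_pow_left₀ (by norm_num) (by linarith [Real.exp_one_gt_d9]) m
        _ = Real.exp m := by rw [← Real.exp_nat_mul, mul_one]
        _ ≤ Real.exp ((m : ℝ) ^ 2) := Real.exp_le_exp.2 (by
            exact_mod_cast Nat.le_self_pow two_ne_zero m)
    rw [Real.exp_neg, Int.cast_natCast, one_div, inv_pow]
    exact inv_anti₀ (by positivity) h2
  simp only [nsmul_eq_mul, Int.cast_zero]
  norm_num
  norm_num at h
  linarith

/-- An exponential-moment count: each point of the net satisfies 1 ≤ exp(4|J| - ∑ z²), and the sum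
of exp(-∑ z²) over the enclosing box factorizes into |J| one-dimensional sums, each at most 5 ≤ e².
-/
theorem card_latticeNet_le {ι : Type*} [Fintype ι] [DecidableEq ι] (J : Finset ι) :
    ((latticeNet J).card : ℝ) ≤ Real.exp (6 * J.card) := by
  have h5 : (5 : ℝ) ≤ Real.exp 2 := by
    have := Real.exp_one_gt_d9
    rw [show (2 : ℝ) = 1 + 1 by norm_num, Real.exp_add]
    nlinarith
  calc ((latticeNet J).card : ℝ)
      = ∑ z ∈ latticeNet J, 1 := by simp
    _ ≤ ∑ z ∈ latticeNet J, Real.exp (4 * J.card) * ∏ q ∈ J, Real.exp (-(z q : ℝ) ^ 2) := by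
        refine Finset.sum_le_sum fun z hz => ?_
        rw [← Real.exp_sum, ← Real.exp_add, Finset.sum_neg_distrib]
        have := (Finset.mem_filter.1 hz).2
        exact Real.one_le_exp (by linarith)
    _ ≤ ∑ z ∈ Fintype.piFinset fun q => if q ∈ J then
          Finset.Icc (-(4 * J.card : ℤ)) (4 * J.card) else {0},
          Real.exp (4 * J.card) * ∏ q ∈ J, Real.exp (-(z q : ℝ) ^ 2) :=
        Finset.sum_le_sum_of_subset_of_nonneg (Finset.filter_subset _ _)
          fun _ _ _ => by positivity
    _ = Real.exp (4 * J.card) * ∏ q, ∑ m ∈ (if q ∈ J then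
          Finset.Icc (-(4 * J.card : ℤ)) (4 * J.card) else {0}),
          (if q ∈ J then Real.exp (-(m : ℝ) ^ 2) else 1) := by
        rw [← Finset.mul_sum, Finset.prod_univ_sum]
        congr 1
        refine Finset.sum_congr rfl fun z _ => ?_
        rw [Finset.prod_ite_mem, Finset.univ_inter]
    _ ≤ Real.exp (4 * J.card) * ∏ q, (if q ∈ J then Real.exp 2 else 1) := by
        refine mul_le_mul_of_nonneg_left (Finset.prod_le_prod (fun q _ =>
          Finset.sum_nonneg fun m _ => by split_ifs <;> positivity) fun q _ => ?_)
          (Real.exp_nonneg _)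
        split_ifs with hq
        · exact (by exact_mod_cast sum_Icc_exp_neg_sq_le (4 * J.card) :
            ∑ m ∈ Finset.Icc (-(4 * J.card : ℤ)) (4 * J.card), Real.exp (-(m : ℝ) ^ 2) ≤ 5).trans h5
        · simp
    _ = Real.exp (6 * J.card) := by
        rw [Finset.prod_ite_mem, Finset.univ_inter, Finset.prod_const, ← Real.exp_nat_mul,
          ← Real.exp_add]
        ring_nf

end Lattice

section BlockOuter

/-! ### Block matrices with blocks of rank one -/

/-- The matrix whose `(k, l)` block is the outer product of the parts of `x` and `v` that belong
to the blocks `(k, l)` and `(l, k)`. -/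
def blockOuter {n K : ℕ} (c : Fin n → Fin K) (x v : Fin n × Fin K → ℝ) :
    Matrix (Fin n) (Fin n) ℝ :=
  Matrix.of fun i j => x (i, c j) * v (j, c i)

/-- The squared norm of the part of `v` that belongs to the block `(k, l)`. -/
noncomputable def blockNormSq {n K : ℕ} (c : Fin n → Fin K) (v : Fin n × Fin K → ℝ)
    (k l : Fin K) : ℝ :=
  ∑ j, if c j = k then v (j, l) ^ 2 else 0

/-- The positions of `J` that belong to the block `b`. -/
def blockSupp {n K : ℕ} (c : Fin n → Fin K) (J : Finset (Fin n × Fin K)) (b : Fin K × Fin K) :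
    Finset (Fin n × Fin K) :=
  J.filter fun q => (c q.1, q.2) = b

variable {n K : ℕ} {c : Fin n → Fin K} {J : Finset (Fin n × Fin K)}

theorem sum_comp_eq_sum_fiber (c : Fin n → Fin K) (f : Fin n → Fin K → ℝ) :
    ∑ j, f j (c j) = ∑ l, ∑ j, if c j = l then f j l else 0 := by
  rw [Finset.sum_comm]
  simp

theorem blockNormSq_nonneg (c : Fin n → Fin K) (v : Fin n × Fin K → ℝ) (k l : Fin K) :
    0 ≤ blockNormSq c v k l :=
  Finset.sum_nonneg fun j _ => by split_ifs <;> positivity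

theorem frobInner_blockOuter_right (E : Matrix (Fin n) (Fin n) ℝ) (x v : Fin n × Fin K → ℝ) :
    frobInner E (blockOuter c x v) =
      ∑ q : Fin n × Fin K, (∑ i, if c i = q.2 then E i q.1 * x (i, c q.1) else 0) * v q := by
  rw [frobInner, Finset.sum_comm, Fintype.sum_prod_type]
  refine Finset.sum_congr rfl fun j _ => ?_
  simp only [blockOuter, Matrix.of_apply]
  rw [sum_comp_eq_sum_fiber c (fun i k => E i j * (x (i, c j) * v (j, k)))]
  refine Finset.sum_congr rfl fun k _ => ?_
  rw [Finset.sum_mul]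
  refine Finset.sum_congr rfl fun i _ => ?_
  split_ifs <;> ring

theorem frobInner_blockOuter_left (E : Matrix (Fin n) (Fin n) ℝ) (x v : Fin n × Fin K → ℝ) :
    frobInner E (blockOuter c x v) =
      ∑ q : Fin n × Fin K, (∑ j, if c j = q.2 then E q.1 j * v (j, c q.1) else 0) * x q := by
  rw [frobInner, Fintype.sum_prod_type]
  refine Finset.sum_congr rfl fun i _ => ?_
  simp only [blockOuter, Matrix.of_apply]
  rw [sum_comp_eq_sum_fiber c (fun j l => E i j * (x (i, l) * v (j, c i)))]
  refine Finset.sum_congr rfl fun k _ => ?_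
  rw [Finset.sum_mul]
  refine Finset.sum_congr rfl fun j _ => ?_
  split_ifs <;> ring

theorem frobSq_blockOuter (x v : Fin n × Fin K → ℝ) :
    frobSq (blockOuter c x v) = ∑ q : Fin n × Fin K, x q ^ 2 * blockNormSq c v q.2 (c q.1) := by
  rw [frobSq, Fintype.sum_prod_type]
  refine Finset.sum_congr rfl fun i _ => ?_
  simp only [blockOuter, Matrix.of_apply, blockNormSq]
  rw [sum_comp_eq_sum_fiber c (fun j l => (x (i, l) * v (j, c i)) ^ 2)]
  refine Finset.sum_congr rfl fun k _ => ?_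
  rw [Finset.mul_sum]
  refine Finset.sum_congr rfl fun j _ => ?_
  split_ifs <;> ring

theorem sum_eq_sum_blockSupp (c : Fin n → Fin K) (J : Finset (Fin n × Fin K))
    (f : Fin n × Fin K → ℝ) : ∑ q ∈ J, f q = ∑ b, ∑ q ∈ blockSupp c J b, f q :=
  (Finset.sum_fiberwise J (fun q => (c q.1, q.2)) f).symm

theorem card_eq_sum_blockSupp (c : Fin n → Fin K) (J : Finset (Fin n × Fin K)) :
    (J.card : ℝ) = ∑ b, ((blockSupp c J b).card : ℝ) := by
  simpa using sum_eq_sum_blockSupp c J fun _ => 1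

theorem blockNormSq_eq_sum_blockSupp {v : Fin n × Fin K → ℝ} (hv : ∀ q ∉ J, v q = 0)
    (k l : Fin K) : blockNormSq c v k l = ∑ q ∈ blockSupp c J (k, l), v q ^ 2 := by
  have h : ∑ q ∈ blockSupp c J (k, l), v q ^ 2 =
      ∑ q : Fin n × Fin K, if (c q.1, q.2) = (k, l) then v q ^ 2 else 0 := by
    rw [blockSupp, Finset.sum_filter]
    refine Finset.sum_subset (Finset.subset_univ _) fun q _ hq => ?_
    simp [hv q hq]
  rw [h, Fintype.sum_prod_type, blockNormSq]
  refine Finset.sum_congr rfl fun j _ => ?_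
  by_cases hj : c j = k <;> simp [hj]

/-- The rank-one block matrix that belongs to a pair of integer points. -/
noncomputable def latticeOuter (c : Fin n → Fin K) (J : Finset (Fin n × Fin K))
    (z z' : Fin n × Fin K → ℤ) : Matrix (Fin n) (Fin n) ℝ :=
  blockOuter c (fun q => z q / (2 * √J.card))
    fun q => z' q / (2 * √(blockSupp c J (c q.1, q.2)).card)

theorem sum_div_sq_le_one {ι : Type*} {s : Finset ι} {z : ι → ℤ}
    (h : ∑ q ∈ s, (z q : ℝ) ^ 2 ≤ 4 * s.card) :
    ∑ q ∈ s, ((z q : ℝ) / (2 * √s.card)) ^ 2 ≤ 1 := by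
  simp_rw [div_pow, mul_pow, Real.sq_sqrt (Nat.cast_nonneg s.card)]
  rw [← Finset.sum_div]
  exact div_le_one_of_le₀ (by linarith) (by positivity)

variable {E : Matrix (Fin n) (Fin n) ℝ} {B : ℝ}

/-- A bound on a bilinear form over the lattice net in the second variable extends to the product of
the unit balls of all blocks. -/
theorem frobInner_le_of_lattice_right (hB : 0 ≤ B)
    (h : ∀ z ∈ latticeNet J, ∀ z' ∈ latticeNet J, frobInner E (latticeOuter c J z z') ≤
      √(frobSq (latticeOuter c J z z')) * B)
    {z : Fin n × Fin K → ℤ} (hz0 : ∀ q ∉ J, z q = 0)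
    (hz : ∑ q ∈ J, (z q : ℝ) ^ 2 ≤ 4 * J.card)
    {v : Fin n × Fin K → ℝ} (hv : ∀ q ∉ J, v q = 0) (hv1 : ∀ k l, blockNormSq c v k l ≤ 1) :
    frobInner E (blockOuter c (fun q => z q / (2 * √J.card)) v) ≤ 2 * B := by
  set x : Fin n × Fin K → ℝ := fun q => z q / (2 * √J.card) with hx
  set g : Fin n × Fin K → ℝ := fun q => ∑ i, if c i = q.2 then E i q.1 * x (i, c q.1) else 0
    with hg
  choose Z hZ0 hZ1 hZ2 using fun b => exists_lattice_dual (blockSupp c J b) g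
  -- The dual points of the separate blocks are glued into one integer point. It lies in the net of
  -- J because the bounds 4|J_b| add up to 4|J|, and it controls the sum of the block norms of `g`
  -- all at once.
  set z' : Fin n × Fin K → ℤ := fun q => Z (c q.1, q.2) q with hz'
  have hzZ : ∀ b, ∀ q ∈ blockSupp c J b, z' q = Z b q := fun b q hq => by
    rw [hz', ← (Finset.mem_filter.1 hq).2]
  have hz'0 : ∀ q ∉ J, z' q = 0 := fun q hq =>
    hZ0 _ q fun hq' => hq (Finset.mem_filter.1 hq').1
  have hz'b : ∀ b, ∑ q ∈ blockSupp c J b, (z' q : ℝ) ^ 2 ≤ 4 * (blockSupp c J b).card := by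
    intro b
    rw [Finset.sum_congr rfl fun q hq => by rw [hzZ b q hq]]
    exact hZ1 b
  have hz'1 : ∑ q ∈ J, (z' q : ℝ) ^ 2 ≤ 4 * J.card := by
    rw [sum_eq_sum_blockSupp c, card_eq_sum_blockSupp c J, Finset.mul_sum]
    exact Finset.sum_le_sum fun b _ => hz'b b
  have hnorm : frobSq (latticeOuter c J z z') ≤ 1 := by
    rw [latticeOuter, frobSq_blockOuter]
    refine le_trans (Finset.sum_le_sum fun q _ => mul_le_of_le_one_right (sq_nonneg _) ?_)
      (le_trans (le_of_eq ?_) (sum_div_sq_le_one hz))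
    · rw [blockNormSq_eq_sum_blockSupp (J := J) (fun q hq => by simp [hz'0 q hq])]
      refine le_trans (le_of_eq (Finset.sum_congr rfl fun p hp => ?_))
        (sum_div_sq_le_one (hz'b (q.2, c q.1)))
      rw [(Finset.mem_filter.1 hp).2]
    · exact (Finset.sum_subset (Finset.subset_univ _) fun q _ hq => by simp [hz0 q hq]).symm
  have hsum : ∑ b, √(∑ q ∈ blockSupp c J b, g q ^ 2) ≤ 2 * B := by
    have h1 := h z (mem_latticeNet hz0 hz) z' (mem_latticeNet hz'0 hz'1)
    have h2 : √(frobSq (latticeOuter c J z z')) * B ≤ B :=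
      mul_le_of_le_one_left hB (Real.sqrt_le_one.2 hnorm)
    have h3 : ∑ b, √(∑ q ∈ blockSupp c J b, g q ^ 2) / 2 ≤
        frobInner E (latticeOuter c J z z') := by
      rw [latticeOuter, frobInner_blockOuter_right,
        ← Finset.sum_subset (Finset.subset_univ J) fun q _ hq => by simp [hz'0 q hq],
        sum_eq_sum_blockSupp c]
      refine Finset.sum_le_sum fun b _ => (hZ2 b).trans (le_of_eq
        (Finset.sum_congr rfl fun q hq => ?_))
      rw [hzZ b q hq, (Finset.mem_filter.1 hq).2]
    rw [← Finset.sum_div] at h3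
    linarith
  rw [frobInner_blockOuter_right,
    ← Finset.sum_subset (Finset.subset_univ J) fun q _ hq => by simp [hv q hq],
    sum_eq_sum_blockSupp c]
  refine (Finset.sum_le_sum fun b _ => ?_).trans hsum
  refine (Real.sum_mul_le_sqrt_mul_sqrt _ _ _).trans (mul_le_of_le_one_right (Real.sqrt_nonneg _) ?_)
  rw [Real.sqrt_le_one]
  rw [← blockNormSq_eq_sum_blockSupp hv]
  exact hv1 _ _

/-- Duality in the remaining variable: testing with the lattice point dual to `g` bounds ‖g‖ on J,
and Cauchy-Schwarz does the rest. Each of the two discretizations contributes a factor 2. -/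
theorem frobInner_le_of_lattice_normalized (hB : 0 ≤ B)
    (h : ∀ z ∈ latticeNet J, ∀ z' ∈ latticeNet J, frobInner E (latticeOuter c J z z') ≤
      √(frobSq (latticeOuter c J z z')) * B)
    {x v : Fin n × Fin K → ℝ} (hx : ∀ q ∉ J, x q = 0) (hv : ∀ q ∉ J, v q = 0)
    (hv1 : ∀ k l, blockNormSq c v k l ≤ 1) :
    frobInner E (blockOuter c x v) ≤ 4 * B * √(∑ q, x q ^ 2) := by
  set g : Fin n × Fin K → ℝ := fun q => ∑ j, if c j = q.2 then E q.1 j * v (j, c q.1) else 0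
    with hg
  obtain ⟨z, hz0, hz1, hz2⟩ := exists_lattice_dual J g
  have h1 := frobInner_le_of_lattice_right hB h hz0 hz1 hv hv1
  rw [frobInner_blockOuter_left,
    ← Finset.sum_subset (Finset.subset_univ J) fun q _ hq => by simp [hz0 q hq]] at h1
  have h2 : √(∑ q ∈ J, g q ^ 2) ≤ 4 * B := by linarith
  rw [frobInner_blockOuter_left,
    ← Finset.sum_subset (Finset.subset_univ J) fun q _ hq => by simp [hx q hq],
    ← Finset.sum_subset (Finset.subset_univ J) fun q _ hq => by simp [hx q hq]]
  exact (Real.sum_mul_le_sqrt_mul_sqrt _ _ _).trans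
    (mul_le_mul_of_nonneg_right h2 (Real.sqrt_nonneg _))

/-- A bound on the noise over pairs of lattice points controls all matrices with rank-one blocks
supported in `J`. -/
theorem frobInner_blockOuter_le_of_lattice (hB : 0 ≤ B)
    (h : ∀ z ∈ latticeNet J, ∀ z' ∈ latticeNet J, frobInner E (latticeOuter c J z z') ≤
      √(frobSq (latticeOuter c J z z')) * B)
    {x v : Fin n × Fin K → ℝ} (hx : ∀ q ∉ J, x q = 0) (hv : ∀ q ∉ J, v q = 0) :
    frobInner E (blockOuter c x v) ≤ 4 * B * √(frobSq (blockOuter c x v)) := by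
  -- The norm of each block part of `v` is moved into `x`, so that ‖x'‖ is the Frobenius norm of the
  -- whole matrix. Blocks where `v` vanishes are harmless, division by zero giving zero.
  set x' : Fin n × Fin K → ℝ := fun q => x q * √(blockNormSq c v q.2 (c q.1)) with hx'
  set v' : Fin n × Fin K → ℝ := fun q => v q / √(blockNormSq c v (c q.1) q.2) with hv'
  have houter : blockOuter c x' v' = blockOuter c x v := by
    ext i j
    simp only [blockOuter, Matrix.of_apply, hx', hv']
    rcases (blockNormSq_nonneg c v (c j) (c i)).eq_or_lt with h0 | h0
    · have : v (j, c i) = 0 := by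
        have := (Finset.sum_eq_zero_iff_of_nonneg fun m _ => by split_ifs <;> positivity).1
          h0.symm j (Finset.mem_univ j)
        simpa using this
      simp [this]
    · have := Real.sqrt_pos.2 h0
      field_simp
  have hnorm : ∑ q, x' q ^ 2 = frobSq (blockOuter c x v) := by
    rw [frobSq_blockOuter]
    refine Finset.sum_congr rfl fun q _ => ?_
    rw [hx', mul_pow, Real.sq_sqrt (blockNormSq_nonneg _ _ _ _)]
  rw [← hnorm, ← houter]
  refine frobInner_le_of_lattice_normalized hB h (fun q hq => by simp [hx', hx q hq])
    (fun q hq => by simp [hv', hv q hq]) fun k l => ?_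
  have : blockNormSq c v' k l = blockNormSq c v k l / blockNormSq c v k l := by
    rw [blockNormSq]
    conv_rhs => rw [blockNormSq, Finset.sum_div]
    refine Finset.sum_congr rfl fun j _ => ?_
    split_ifs with hj
    · rw [hv', div_pow, Real.sq_sqrt (blockNormSq_nonneg _ _ _ _), hj]; rfl
    · simp
  rw [this]
  exact div_self_le_one _

end BlockOuter

section RankOneClass

/-! ### The class of matrices with rank-one blocks and given supports -/

/-- The matrices all of whose blocks have vanishing `2 × 2` minors and are supported in
`J_{k,l} × J_{l,k}`. -/
def rankOneClass {n K : ℕ} (c : Fin n → Fin K) (J : Finset (Fin n × Fin K)) :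
    Set (Matrix (Fin n) (Fin n) ℝ) :=
  {T | (∀ i j i' j', c i = c i' → c j = c j' → T i j * T i' j' = T i j' * T i' j) ∧
    ∀ i j, ¬((i, c j) ∈ J ∧ (j, c i) ∈ J) → T i j = 0}

variable {n K : ℕ} {c : Fin n → Fin K} {J : Finset (Fin n × Fin K)}

/-- In a nonzero block choose a pivot: vanishing minors make the block the product of the pivot's
column and the pivot's row divided by the pivot. Both inherit their supports from the block. -/
theorem exists_eq_blockOuter {T : Matrix (Fin n) (Fin n) ℝ} (hT : T ∈ rankOneClass c J) :
    ∃ a b : Fin n × Fin K → ℝ, (∀ q ∉ J, a q = 0) ∧ (∀ q ∉ J, b q = 0) ∧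
      T = blockOuter c a b := by
  classical
  have hex : ∀ k l : Fin K, ∃ a b : Fin n → ℝ,
      (∀ i, c i = k → (i, l) ∉ J → a i = 0) ∧ (∀ j, c j = l → (j, k) ∉ J → b j = 0) ∧
      ∀ i j, c i = k → c j = l → T i j = a i * b j := by
    intro k l
    by_cases h : ∃ i₀ j₀, c i₀ = k ∧ c j₀ = l ∧ T i₀ j₀ ≠ 0
    · obtain ⟨i₀, j₀, hi, hj, h0⟩ := h
      refine ⟨fun i => T i j₀, fun j => T i₀ j / T i₀ j₀, fun i _ hiJ => ?_, fun j _ hjJ => ?_,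
        fun i j hik hjl => ?_⟩
      · exact hT.2 i j₀ fun h => hiJ (hj ▸ h.1)
      · have : T i₀ j = 0 := hT.2 i₀ j fun h => hjJ (hi ▸ h.2)
        simp [this]
      · have := hT.1 i j i₀ j₀ (hik.trans hi.symm) (hjl.trans hj.symm)
        field_simp
        exact this
    · push Not at h
      exact ⟨fun _ => 0, fun _ => 0, fun _ _ _ => rfl, fun _ _ _ => rfl,
        fun i j hi hj => by simp [h i j hi hj]⟩
  choose a b ha hb hab using hex
  refine ⟨fun q => a (c q.1) q.2 q.1, fun q => b q.2 (c q.1) q.1,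
    fun q hq => ha _ _ _ rfl hq, fun q hq => hb _ _ _ rfl hq, ?_⟩
  ext i j
  exact hab _ _ i j rfl rfl

/-- Vanishing minors and vanishing entries are closed conditions, whereas the exact supports of
feasible points are not; hence the larger class. The minimizer depends on the model and on `P` but
not on the data. -/
theorem exists_nearest_rankOneClass (c : Fin n → Fin K) (J : Finset (Fin n × Fin K))
    (P : Matrix (Fin n) (Fin n) ℝ) :
    ∃ T₀ ∈ rankOneClass c J, ∀ T ∈ rankOneClass c J, frobSq (T₀ - P) ≤ frobSq (T - P) := by
  let toMat : EuclideanSpace ℝ (Fin n × Fin n) → Matrix (Fin n) (Fin n) ℝ :=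
    fun y => Matrix.of fun i j => y (i, j)
  have hdist : ∀ y (Q : Matrix (Fin n) (Fin n) ℝ),
      dist (WithLp.toLp 2 fun p : Fin n × Fin n => Q p.1 p.2) y ^ 2 = frobSq (toMat y - Q) := by
    intro y Q
    rw [EuclideanSpace.dist_eq, Real.sq_sqrt (Finset.sum_nonneg fun _ _ => sq_nonneg _),
      Fintype.sum_prod_type]
    refine Finset.sum_congr rfl fun i _ => Finset.sum_congr rfl fun j _ => ?_
    rw [Real.dist_eq, sq_abs]
    simp only [Matrix.sub_apply, toMat, Matrix.of_apply]
    ring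
  have hclosed : IsClosed (toMat ⁻¹' rankOneClass c J) := by
    have hent : ∀ i j, Continuous fun y => toMat y i j := fun i j => by
      simp only [toMat, Matrix.of_apply]; fun_prop
    have hset : toMat ⁻¹' rankOneClass c J =
        (⋂ i, ⋂ j, ⋂ i', ⋂ j', ⋂ (_ : c i = c i'), ⋂ (_ : c j = c j'),
          {y | toMat y i j * toMat y i' j' = toMat y i j' * toMat y i' j}) ∩
        ⋂ i, ⋂ j, ⋂ (_ : ¬((i, c j) ∈ J ∧ (j, c i) ∈ J)), {y | toMat y i j = 0} := by
      ext y
      simp [rankOneClass]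
    rw [hset]
    refine IsClosed.inter ?_ ?_
    · refine isClosed_iInter fun i => isClosed_iInter fun j => isClosed_iInter fun i' =>
        isClosed_iInter fun j' => isClosed_iInter fun _ => isClosed_iInter fun _ => ?_
      exact isClosed_eq ((hent _ _).mul (hent _ _)) ((hent _ _).mul (hent _ _))
    · refine isClosed_iInter fun i => isClosed_iInter fun j => isClosed_iInter fun _ => ?_
      exact isClosed_eq (hent _ _) continuous_const
  have hne : (toMat ⁻¹' rankOneClass c J).Nonempty :=
    ⟨0, by simp [toMat, rankOneClass]⟩
  obtain ⟨y, hy, hmin⟩ := hclosed.exists_infDist_eq_dist hne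
    (WithLp.toLp 2 fun p : Fin n × Fin n => P p.1 p.2)
  refine ⟨toMat y, hy, fun T hT => ?_⟩
  have hT' : toMat (WithLp.toLp 2 fun p : Fin n × Fin n => T p.1 p.2) = T := by
    ext i j; simp [toMat]
  have hmem : (WithLp.toLp 2 fun p : Fin n × Fin n => T p.1 p.2) ∈ toMat ⁻¹' rankOneClass c J := by
    rw [Set.mem_preimage, hT']; exact hT
  have h1 := Metric.infDist_le_dist_of_mem
    (x := WithLp.toLp 2 fun p : Fin n × Fin n => P p.1 p.2) hmem
  rw [hmin] at h1
  have h2 := pow_le_pow_left₀ dist_nonneg h1 2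
  rwa [hdist, hdist, hT'] at h2

/-- The difference of two outer products is a sum of two outer products, neither of which exceeds
it in norm. -/
theorem exists_split_outer {ι : Type*} (s t : Finset ι) (a b a₀ b₀ : ι → ℝ) :
    ∃ x y x' y' : ι → ℝ,
      (∀ i ∈ s, a i = 0 → a₀ i = 0 → x i = 0 ∧ x' i = 0) ∧
      (∀ j ∈ t, b j = 0 → b₀ j = 0 → y j = 0 ∧ y' j = 0) ∧
      (∀ i ∈ s, ∀ j ∈ t, a i * b j - a₀ i * b₀ j = x i * y j + x' i * y' j) ∧
      ∑ i ∈ s, ∑ j ∈ t, (x i * y j) ^ 2 ≤ ∑ i ∈ s, ∑ j ∈ t, (a i * b j - a₀ i * b₀ j) ^ 2 ∧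
      ∑ i ∈ s, ∑ j ∈ t, (x' i * y' j) ^ 2 ≤ ∑ i ∈ s, ∑ j ∈ t, (a i * b j - a₀ i * b₀ j) ^ 2 := by
  -- With a₀ - τa orthogonal to a, the two terms of abᵀ - a₀b₀ᵀ = a(b - τb₀)ᵀ - (a₀ - τa)b₀ᵀ are
  -- orthogonal, and Pythagoras bounds both.
  obtain ⟨τ, hτ⟩ : ∃ τ : ℝ, ∑ i ∈ s, a i * (a₀ i - τ * a i) = 0 := by
    have hexp : ∀ τ : ℝ, ∑ i ∈ s, a i * (a₀ i - τ * a i)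
        = ∑ i ∈ s, a i * a₀ i - τ * ∑ i ∈ s, a i ^ 2 := fun τ => by
      rw [Finset.mul_sum, ← Finset.sum_sub_distrib]
      exact Finset.sum_congr rfl fun i _ => by ring
    by_cases h : ∑ i ∈ s, a i ^ 2 = 0
    · refine ⟨0, Finset.sum_eq_zero fun i hi => ?_⟩
      have := (Finset.sum_eq_zero_iff_of_nonneg fun q _ => sq_nonneg (a q)).1 h i hi
      rw [pow_eq_zero_iff two_ne_zero] at this
      simp [this]
    · exact ⟨(∑ i ∈ s, a i * a₀ i) / ∑ i ∈ s, a i ^ 2, by rw [hexp]; field_simp; simp⟩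
  set y : ι → ℝ := fun j => b j - τ * b₀ j with hy
  set x' : ι → ℝ := fun i => -(a₀ i - τ * a i) with hx'
  have hpyth : ∑ i ∈ s, ∑ j ∈ t, (a i * b j - a₀ i * b₀ j) ^ 2 =
      ∑ i ∈ s, ∑ j ∈ t, (a i * y j) ^ 2 + ∑ i ∈ s, ∑ j ∈ t, (x' i * b₀ j) ^ 2 := by
    have h0 : ∑ i ∈ s, ∑ j ∈ t, 2 * (a i * (a₀ i - τ * a i)) * (y j * b₀ j) = 0 := by
      rw [← Finset.sum_mul_sum, ← Finset.mul_sum, hτ]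
      simp
    rw [← Finset.sum_add_distrib, ← sub_zero (∑ i ∈ s, _), ← sub_zero (∑ i ∈ s, (_ + _))]
    nth_rewrite 2 [← h0]
    rw [sub_zero, ← Finset.sum_sub_distrib]
    refine Finset.sum_congr rfl fun i _ => ?_
    rw [← Finset.sum_add_distrib, ← Finset.sum_sub_distrib]
    refine Finset.sum_congr rfl fun j _ => ?_
    simp only [hy, hx']
    ring
  have hn1 : 0 ≤ ∑ i ∈ s, ∑ j ∈ t, (a i * y j) ^ 2 :=
    Finset.sum_nonneg fun _ _ => Finset.sum_nonneg fun _ _ => sq_nonneg _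
  have hn2 : 0 ≤ ∑ i ∈ s, ∑ j ∈ t, (x' i * b₀ j) ^ 2 :=
    Finset.sum_nonneg fun _ _ => Finset.sum_nonneg fun _ _ => sq_nonneg _
  refine ⟨a, y, x', b₀, fun i _ h1 h2 => ⟨h1, by simp [hx', h1, h2]⟩,
    fun j _ h1 h2 => ⟨by simp [hy, h1, h2], h2⟩, fun i _ j _ => ?_, by linarith, by linarith⟩
  simp only [hy, hx']
  ring

theorem frobSq_eq_sum_blocks (c : Fin n → Fin K) (M : Matrix (Fin n) (Fin n) ℝ) :
    frobSq M = ∑ k, ∑ l, ∑ i with c i = k, ∑ j with c j = l, M i j ^ 2 := by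
  rw [frobSq, ← Finset.sum_fiberwise Finset.univ c fun i => ∑ j, M i j ^ 2]
  refine Finset.sum_congr rfl fun k _ => ?_
  conv_rhs => rw [Finset.sum_comm]
  refine Finset.sum_congr rfl fun i _ => ?_
  exact (Finset.sum_fiberwise Finset.univ c fun j => M i j ^ 2).symm

theorem exists_split_blockOuter {a b a₀ b₀ : Fin n × Fin K → ℝ}
    (ha : ∀ q ∉ J, a q = 0) (hb : ∀ q ∉ J, b q = 0)
    (ha₀ : ∀ q ∉ J, a₀ q = 0) (hb₀ : ∀ q ∉ J, b₀ q = 0) :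
    ∃ x y x' y' : Fin n × Fin K → ℝ,
      (∀ q ∉ J, x q = 0) ∧ (∀ q ∉ J, y q = 0) ∧ (∀ q ∉ J, x' q = 0) ∧ (∀ q ∉ J, y' q = 0) ∧
      blockOuter c a b - blockOuter c a₀ b₀ = blockOuter c x y + blockOuter c x' y' ∧
      frobSq (blockOuter c x y) ≤ frobSq (blockOuter c a b - blockOuter c a₀ b₀) ∧
      frobSq (blockOuter c x' y') ≤ frobSq (blockOuter c a b - blockOuter c a₀ b₀) := by
  choose x y x' y' h1 h2 h3 h4 h5 using fun k l => exists_split_outer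
    (Finset.univ.filter fun i => c i = k) (Finset.univ.filter fun j => c j = l)
    (fun i => a (i, l)) (fun j => b (j, k)) (fun i => a₀ (i, l)) (fun j => b₀ (j, k))
  refine ⟨fun q => x (c q.1) q.2 q.1, fun q => y q.2 (c q.1) q.1, fun q => x' (c q.1) q.2 q.1,
    fun q => y' q.2 (c q.1) q.1, fun q hq => ?_, fun q hq => ?_, fun q hq => ?_, fun q hq => ?_,
    ?_, ?_, ?_⟩
  · exact (h1 (c q.1) q.2 q.1 (by simp) (ha q hq) (ha₀ q hq)).1
  · exact (h2 q.2 (c q.1) q.1 (by simp) (hb q hq) (hb₀ q hq)).1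
  · exact (h1 (c q.1) q.2 q.1 (by simp) (ha q hq) (ha₀ q hq)).2
  · exact (h2 q.2 (c q.1) q.1 (by simp) (hb q hq) (hb₀ q hq)).2
  · ext i j
    exact h3 (c i) (c j) i (by simp) j (by simp)
  · rw [frobSq_eq_sum_blocks c, frobSq_eq_sum_blocks c]
    refine Finset.sum_le_sum fun k _ => Finset.sum_le_sum fun l _ =>
      le_trans (le_of_eq ?_) ((h4 k l).trans (le_of_eq ?_))
    all_goals
      refine Finset.sum_congr rfl fun i hi => Finset.sum_congr rfl fun j hj => ?_
      obtain rfl := (Finset.mem_filter.1 hi).2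
      obtain rfl := (Finset.mem_filter.1 hj).2
      rfl
  · rw [frobSq_eq_sum_blocks c, frobSq_eq_sum_blocks c]
    refine Finset.sum_le_sum fun k _ => Finset.sum_le_sum fun l _ =>
      le_trans (le_of_eq ?_) ((h5 k l).trans (le_of_eq ?_))
    all_goals
      refine Finset.sum_congr rfl fun i hi => Finset.sum_congr rfl fun j hj => ?_
      obtain rfl := (Finset.mem_filter.1 hi).2
      obtain rfl := (Finset.mem_filter.1 hj).2
      rfl

theorem frobInner_add (E W W' : Matrix (Fin n) (Fin n) ℝ) :
    frobInner E (W + W') = frobInner E W + frobInner E W' := by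
  simp only [frobInner, Matrix.add_apply, mul_add, Finset.sum_add_distrib]

/-- A bound on the noise over pairs of lattice points controls differences of two members of the
class of matrices with rank-one blocks. -/
theorem frobInner_sub_le_of_lattice {E : Matrix (Fin n) (Fin n) ℝ} {B : ℝ} (hB : 0 ≤ B)
    (h : ∀ z ∈ latticeNet J, ∀ z' ∈ latticeNet J, frobInner E (latticeOuter c J z z') ≤
      √(frobSq (latticeOuter c J z z')) * B)
    {T T₀ : Matrix (Fin n) (Fin n) ℝ} (hT : T ∈ rankOneClass c J)
    (hT₀ : T₀ ∈ rankOneClass c J) :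
    frobInner E (T - T₀) ≤ 8 * B * √(frobSq (T - T₀)) := by
  obtain ⟨a, b, ha, hb, rfl⟩ := exists_eq_blockOuter hT
  obtain ⟨a₀, b₀, ha₀, hb₀, rfl⟩ := exists_eq_blockOuter hT₀
  obtain ⟨x, y, x', y', hx, hy, hx', hy', heq, h1, h2⟩ :=
    exists_split_blockOuter (c := c) ha hb ha₀ hb₀
  have e1 := frobInner_blockOuter_le_of_lattice hB h hx hy
  have e2 := frobInner_blockOuter_le_of_lattice hB h hx' hy'
  have s1 := mul_le_mul_of_nonneg_left (Real.sqrt_le_sqrt h1) (by positivity : 0 ≤ 4 * B)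
  have s2 := mul_le_mul_of_nonneg_left (Real.sqrt_le_sqrt h2) (by positivity : 0 ≤ 4 * B)
  calc frobInner E _ = frobInner E (blockOuter c x y) + frobInner E (blockOuter c x' y') := by
        rw [heq, frobInner_add]
    _ ≤ _ := by linarith

end RankOneClass

section Complexity

/-! ### Complexity of the supports -/

/-- The cost `j ln (N e / j)` of a subset with `j` elements of a set with `N` elements. -/
noncomputable def subsetCost (N j : ℝ) : ℝ := j * Real.log (N * Real.exp 1 / j)

theorem le_subsetCost {N j : ℝ} (hj : 0 ≤ j) (hjN : j ≤ N) : j ≤ subsetCost N j := by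
  rcases hj.eq_or_lt with rfl | h0
  · simp [subsetCost]
  have hN : 0 < N := h0.trans_le hjN
  refine le_mul_of_one_le_right hj ?_
  rw [Real.le_log_iff_exp_le (by positivity), le_div_iff₀ h0, mul_comm]
  gcongr

theorem subsetCost_nonneg {N j : ℝ} (hj : 0 ≤ j) (hjN : j ≤ N) : 0 ≤ subsetCost N j :=
  hj.trans (le_subsetCost hj hjN)

/-- The derivative in j is ln(N/j), nonnegative up to j = N. This is what makes shrinking a support
free of charge. -/
theorem subsetCost_mono {N j j' : ℝ} (hj : 0 ≤ j) (h : j ≤ j') (hN : j' ≤ N) :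
    subsetCost N j ≤ subsetCost N j' := by
  rcases hj.eq_or_lt with rfl | h0
  · simpa [subsetCost] using subsetCost_nonneg h hN
  have h0' : 0 < j' := h0.trans_le h
  have hN0 : 0 < N := h0'.trans_le hN
  have hone : 1 ≤ Real.log (N * Real.exp 1 / j') := by
    rw [Real.le_log_iff_exp_le (by positivity), le_div_iff₀ h0', mul_comm]
    gcongr
  have hsplit : Real.log (N * Real.exp 1 / j) =
      Real.log (N * Real.exp 1 / j') + Real.log (j' / j) := by
    rw [← Real.log_mul (by positivity) (by positivity)]
    congr 1
    field_simp
  have hlog : j * Real.log (j' / j) ≤ j' - j := by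
    have := mul_le_mul_of_nonneg_left (Real.log_le_sub_one_of_pos (div_pos h0' h0)) hj
    rw [mul_sub, mul_div_cancel₀ _ h0.ne'] at this
    linarith
  rw [subsetCost, subsetCost, hsplit]
  nlinarith

theorem choose_le_exp_subsetCost (N j : ℕ) : (N.choose j : ℝ) ≤ Real.exp (subsetCost N j) := by
  rcases Nat.eq_zero_or_pos j with rfl | hj
  · simp [subsetCost]
  rcases Nat.lt_or_ge N j with h | h
  · rw [Nat.choose_eq_zero_of_lt h]
    simpa using (Real.exp_pos _).le
  have hj0 : (0 : ℝ) < j := by exact_mod_cast hj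
  have hN0 : (0 : ℝ) < N := by exact_mod_cast hj.trans_le h
  have h1 : (N.choose j : ℝ) ≤ (N : ℝ) ^ j / j.factorial := Nat.choose_le_pow_div j N
  have h2 : (j : ℝ) ^ j / j.factorial ≤ Real.exp j := Real.pow_div_factorial_le_exp _ hj0.le j
  rw [subsetCost, Real.exp_nat_mul, Real.exp_log (by positivity), div_pow, mul_pow,
    ← Real.exp_nat_mul, mul_one, le_div_iff₀ (by positivity)]
  calc (N.choose j : ℝ) * (j : ℝ) ^ j ≤ (N : ℝ) ^ j / j.factorial * (j : ℝ) ^ j := by gcongr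
    _ = (N : ℝ) ^ j * ((j : ℝ) ^ j / j.factorial) := by ring
    _ ≤ _ := by gcongr

/-- The binomial number of sets of size j uses up one unit of θ. As the cost is at least j, the
remaining θ - 1 leaves a geometric series. -/
theorem sum_exp_neg_subsetCost_le {α : Type*} [Fintype α] {θ r : ℝ} (hθ : 1 ≤ θ)
    (hr : Real.exp (-(θ - 1)) ≤ r) (hr1 : r < 1) :
    ∑ S : Finset α, Real.exp (-(θ * subsetCost (Fintype.card α) S.card)) ≤ (1 - r)⁻¹ := by
  classical
  have hr0 : 0 < r := (Real.exp_pos _).trans_le hr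
  rw [← Finset.powerset_univ, Finset.sum_powerset_apply_card
    (fun j => Real.exp (-(θ * subsetCost (Fintype.card α) j))), Finset.card_univ]
  calc _ ≤ ∑ j ∈ Finset.range (Fintype.card α + 1), r ^ j := by
        refine Finset.sum_le_sum fun j hj => ?_
        have hj' : (j : ℝ) ≤ Fintype.card α := by
          exact_mod_cast Nat.lt_succ_iff.1 (Finset.mem_range.1 hj)
        rw [nsmul_eq_mul]
        calc _ ≤ Real.exp (subsetCost (Fintype.card α) j) *
              Real.exp (-(θ * subsetCost (Fintype.card α) j)) := by
              gcongr
              exact choose_le_exp_subsetCost _ _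
          _ ≤ Real.exp (j * (-(θ - 1))) := by
              rw [← Real.exp_add]
              refine Real.exp_le_exp.2 ?_
              nlinarith [le_subsetCost j.cast_nonneg hj']
          _ ≤ r ^ j := by
              rw [Real.exp_nat_mul]
              gcongr
    _ ≤ (1 - r)⁻¹ := by
        rw [← tsum_geometric_of_lt_one hr0.le hr1]
        exact (summable_geometric_of_lt_one hr0.le hr1).sum_le_tsum _ fun _ _ => by positivity

/-! ### The ingredients of the penalties. -/

variable {n K : ℕ} {c : Fin n → Fin K} {J : Finset (Fin n × Fin K)}

/-- The part of the penalty that is multiplied by `β₁`. -/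
noncomputable def suppCost (a : PenaltyKind) (c : Fin n → Fin K) (J : Finset (Fin n × Fin K)) : ℝ :=
  match a with
  | .separable => ∑ k, ∑ l, subsetCost (commSize c k) (suppSet c J k l).card
  | .nonseparable => subsetCost (n * K) J.card

/-- The part of `Pen⁽⁰⁾` that is multiplied by `β₂`. -/
noncomputable def sizeCost (a : PenaltyKind) (c : Fin n → Fin K) : ℝ :=
  match a with
  | .separable => K * ∑ k, Real.log (commSize c k)
  | .nonseparable => 2 * Real.log n

/-- The cost of the clustering. -/
noncomputable def clusterCost (n K : ℕ) : ℝ := n * Real.log K + Real.log n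

theorem pen_eq (a : PenaltyKind) (β₁ β₂ : ℝ) (c : Fin n → Fin K) (J : Finset (Fin n × Fin K)) :
    pen a β₁ β₂ c J = β₁ * suppCost a c J + β₂ * (sizeCost a c + clusterCost n K) := by
  cases a <;> simp only [pen, suppCost, sizeCost, clusterCost, penZeroSep, penZeroNonsep, penOne,
    subsetCost] <;> ring

theorem clusterCost_nonneg (n K : ℕ) : 0 ≤ clusterCost n K :=
  add_nonneg (mul_nonneg n.cast_nonneg (Real.log_natCast_nonneg K)) (Real.log_natCast_nonneg n)

theorem sizeCost_nonneg (a : PenaltyKind) (c : Fin n → Fin K) : 0 ≤ sizeCost a c := by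
  cases a
  · exact mul_nonneg K.cast_nonneg (Finset.sum_nonneg fun k _ => Real.log_natCast_nonneg _)
  · exact mul_nonneg zero_le_two (Real.log_natCast_nonneg n)

theorem card_suppSet_le (c : Fin n → Fin K) (J : Finset (Fin n × Fin K)) (k l : Fin K) :
    (suppSet c J k l).card ≤ commSize c k :=
  Finset.card_le_univ _

theorem card_supp_le (J : Finset (Fin n × Fin K)) : (J.card : ℝ) ≤ n * K := by
  have := Finset.card_le_univ J
  rw [Fintype.card_prod, Fintype.card_fin, Fintype.card_fin] at this
  exact_mod_cast this

theorem card_suppSet (c : Fin n → Fin K) (J : Finset (Fin n × Fin K)) (k l : Fin K) :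
    (suppSet c J k l).card = (blockSupp c J (k, l)).card := by
  refine Finset.card_bij (fun i _ => (i.1, l)) (fun i hi => ?_) (fun i _ j _ h => ?_)
    fun q hq => ?_
  · simp only [suppSet, Finset.mem_filter] at hi
    simp [blockSupp, hi.2, i.2]
  · exact Subtype.ext (Prod.ext_iff.1 h).1
  · obtain ⟨hqJ, hq⟩ := Finset.mem_filter.1 hq
    obtain ⟨i, m⟩ := q
    simp only [Prod.mk.injEq] at hq
    exact ⟨⟨i, hq.1⟩, by simpa [suppSet, ← hq.2] using hqJ, by simp [hq.2]⟩

theorem card_eq_sum_suppSet (c : Fin n → Fin K) (J : Finset (Fin n × Fin K)) :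
    (J.card : ℝ) = ∑ k, ∑ l, ((suppSet c J k l).card : ℝ) := by
  simp_rw [card_eq_sum_blockSupp c J, Fintype.sum_prod_type, card_suppSet]

theorem card_le_suppCost (a : PenaltyKind) (c : Fin n → Fin K) (J : Finset (Fin n × Fin K)) :
    (J.card : ℝ) ≤ suppCost a c J := by
  cases a
  · rw [card_eq_sum_suppSet c]
    exact Finset.sum_le_sum fun k _ => Finset.sum_le_sum fun l _ =>
      le_subsetCost (Nat.cast_nonneg _) (by exact_mod_cast card_suppSet_le c J k l)
  · exact le_subsetCost (Nat.cast_nonneg _) (card_supp_le J)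

theorem suppCost_mono (a : PenaltyKind) (c : Fin n → Fin K) {J J' : Finset (Fin n × Fin K)}
    (h : J ⊆ J') : suppCost a c J ≤ suppCost a c J' := by
  cases a
  · refine Finset.sum_le_sum fun k _ => Finset.sum_le_sum fun l _ =>
      subsetCost_mono (Nat.cast_nonneg _) ?_ (by exact_mod_cast card_suppSet_le c J' k l)
    have : suppSet c J k l ⊆ suppSet c J' k l := fun i hi => by
      simp only [suppSet, Finset.mem_filter] at hi ⊢
      exact ⟨hi.1, h hi.2⟩
    exact_mod_cast Finset.card_le_card this
  · exact subsetCost_mono (Nat.cast_nonneg _) (by exact_mod_cast Finset.card_le_card h)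
      (card_supp_le J')

/-! ### Supports without single-entry blocks and their total weight. -/

/-- The two communities `k` and `l` both consist of a single node. -/
def SinglePair (c : Fin n → Fin K) (k l : Fin K) : Prop := commSize c k = 1 ∧ commSize c l = 1

open Classical in
/-- The positions of `J` outside the blocks with a single entry. -/
noncomputable def reducedSupp (c : Fin n → Fin K) (J : Finset (Fin n × Fin K)) :
    Finset (Fin n × Fin K) :=
  J.filter fun q => ¬ SinglePair c (c q.1) q.2

open Classical in
/-- The supports that avoid the blocks with a single entry. -/
noncomputable def reducedSupps (c : Fin n → Fin K) : Finset (Finset (Fin n × Fin K)) :=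
  Finset.univ.filter fun J => ∀ q ∈ J, ¬ SinglePair c (c q.1) q.2

theorem reducedSupp_mem (c : Fin n → Fin K) (J : Finset (Fin n × Fin K)) :
    reducedSupp c J ∈ reducedSupps c := by
  simp only [reducedSupps, reducedSupp, Finset.mem_filter, Finset.mem_univ, true_and]
  exact fun q hq => hq.2

theorem reducedSupp_subset (c : Fin n → Fin K) (J : Finset (Fin n × Fin K)) :
    reducedSupp c J ⊆ J := by
  classical
  exact Finset.filter_subset _ _

theorem commSize_pos (hc : Function.Surjective c) (k : Fin K) : 1 ≤ commSize c k := by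
  obtain ⟨i, hi⟩ := hc k
  exact Fintype.card_pos_iff.2 ⟨⟨i, hi⟩⟩

theorem sum_prod_le_prod_sum {ι β : Type*} [Fintype β] {X : β → Type*} (s : Finset ι)
    (f : ι → ∀ b, X b) (hf : Function.Injective f) (t : ∀ b, Finset (X b))
    (hft : ∀ i ∈ s, ∀ b, f i b ∈ t b) (w : ∀ b, X b → ℝ) (hw : ∀ b S, 0 ≤ w b S) :
    ∑ i ∈ s, ∏ b, w b (f i b) ≤ ∏ b, ∑ S ∈ t b, w b S := by
  classical
  rw [Finset.prod_univ_sum, ← Finset.sum_image (f := fun g => ∏ b, w b (g b)) hf.injOn]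
  refine Finset.sum_le_sum_of_subset_of_nonneg (fun g hg => ?_) fun g _ _ =>
    Finset.prod_nonneg fun b _ => hw b _
  obtain ⟨i, hi, rfl⟩ := Finset.mem_image.1 hg
  exact Fintype.mem_piFinset.2 (hft i hi)

theorem suppSet_injective (c : Fin n → Fin K) :
    Function.Injective fun (J : Finset (Fin n × Fin K)) (b : Fin K × Fin K) =>
      suppSet c J b.1 b.2 := by
  intro J J' h
  ext ⟨i, l⟩
  have h1 : suppSet c J (c i) l = suppSet c J' (c i) l := congrFun h (c i, l)
  have h2 := Finset.ext_iff.1 h1 ⟨i, rfl⟩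
  simpa [suppSet] using h2

/-- The contribution of one block to the weight of a support. -/
noncomputable def blockWeight (c : Fin n → Fin K) (θ : ℝ) (b : Fin K × Fin K)
    (S : Finset (Community c b.1)) : ℝ :=
  Real.exp (-(θ * subsetCost (commSize c b.1) S.card)) *
    ((commSize c b.1 : ℝ) * commSize c b.2)⁻¹

/-- Twice K ∑ ln n_k equals the sum of ln n_k + ln n_l over all pairs, so the size cost also splits
over the blocks. -/
theorem exp_neg_separable_eq_prod (hc : Function.Surjective c) (θ : ℝ)
    (J : Finset (Fin n × Fin K)) :
    Real.exp (-(θ * suppCost .separable c J) - 2 * sizeCost .separable c) =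
      ∏ b : Fin K × Fin K, blockWeight c θ b (suppSet c J b.1 b.2) := by
  have hpos : ∀ k, (0 : ℝ) < commSize c k := fun k => by exact_mod_cast commSize_pos hc k
  have hw : ∀ b : Fin K × Fin K, blockWeight c θ b (suppSet c J b.1 b.2) =
      Real.exp (-(θ * subsetCost (commSize c b.1) (suppSet c J b.1 b.2).card) -
        (Real.log (commSize c b.1) + Real.log (commSize c b.2))) := by
    intro b
    rw [blockWeight, sub_eq_add_neg, Real.exp_add, Real.exp_neg (_ + _), Real.exp_add,
      Real.exp_log (hpos _), Real.exp_log (hpos _)]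
  rw [Finset.prod_congr rfl fun b _ => hw b, ← Real.exp_sum, Finset.sum_sub_distrib,
    Finset.sum_neg_distrib, ← Finset.mul_sum, Fintype.sum_prod_type, Finset.sum_add_distrib,
    Fintype.sum_prod_type, Fintype.sum_prod_type, suppCost, sizeCost]
  congr 2
  simp only [Finset.sum_const, Finset.card_univ, Fintype.card_fin, nsmul_eq_mul, ← Finset.mul_sum]
  ring

/-- The geometric series is at most 2, and so is compensated by n_k n_l ≥ 2. A single-entry block
would contribute 1 + e^(-θ), and a product of many such factors is not bounded. -/
theorem sum_blockWeight_le_one (hc : Function.Surjective c) {θ r : ℝ} (hθ : 1 ≤ θ)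
    (hr : Real.exp (-(θ - 1)) ≤ r) (hr1 : r ≤ 1 / 2) {b : Fin K × Fin K}
    (hb : ¬ SinglePair c b.1 b.2) : ∑ S, blockWeight c θ b S ≤ 1 := by
  simp only [blockWeight]
  rw [← Finset.sum_mul]
  have h3 : (2 : ℝ) ≤ (commSize c b.1 : ℝ) * commSize c b.2 := by
    by_contra! h4
    have h5 : commSize c b.1 * commSize c b.2 < 2 := by exact_mod_cast h4
    have h6 := commSize_pos hc b.1
    have h7 := commSize_pos hc b.2
    exact hb ⟨by nlinarith, by nlinarith⟩
  have h4 : ∑ S : Finset (Community c b.1),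
      Real.exp (-(θ * subsetCost (commSize c b.1) S.card)) ≤ 2 := by
    refine (sum_exp_neg_subsetCost_le hθ hr (by linarith)).trans ?_
    rw [inv_le_comm₀ (by linarith) (by norm_num)]
    linarith
  rw [← div_eq_mul_inv]
  exact div_le_one_of_le₀ (h4.trans h3) (by positivity)

open Classical in
theorem sum_exp_neg_separable_le (hc : Function.Surjective c) {θ r : ℝ} (hθ : 1 ≤ θ)
    (hr : Real.exp (-(θ - 1)) ≤ r) (hr1 : r ≤ 1 / 2) :
    ∑ J ∈ reducedSupps c,
      Real.exp (-(θ * suppCost .separable c J) - 2 * sizeCost .separable c) ≤ 1 := by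
  rw [Finset.sum_congr rfl fun J _ => exp_neg_separable_eq_prod hc θ J]
  refine (sum_prod_le_prod_sum (reducedSupps c) _ (suppSet_injective c)
    (fun b => if SinglePair c b.1 b.2 then {∅} else Finset.univ) ?_ (blockWeight c θ) ?_).trans
    (Finset.prod_le_one (fun b _ => Finset.sum_nonneg fun S _ => ?_) fun b _ => ?_)
  · intro J hJ b
    split_ifs with hb
    · rw [Finset.mem_singleton, Finset.eq_empty_iff_forall_notMem]
      intro i hi
      refine (Finset.mem_filter.1 hJ).2 (i.1, b.2) (Finset.mem_filter.1 hi).2 ?_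
      rw [i.2]
      exact hb
    · exact Finset.mem_univ _
  · intro b S
    rw [blockWeight]
    positivity
  · rw [blockWeight]
    positivity
  · split_ifs with hb
    · simp [blockWeight, subsetCost, hb.1, hb.2]
    · exact sum_blockWeight_le_one hc hθ hr hr1 hb

theorem sum_exp_neg_cost_le (a : PenaltyKind) (hc : Function.Surjective c) {θ r : ℝ}
    (hθ : 1 ≤ θ) (hr : Real.exp (-(θ - 1)) ≤ r) (hr1 : r ≤ 1 / 2) :
    ∑ J ∈ reducedSupps c, Real.exp (-(θ * suppCost a c J) - 2 * sizeCost a c) ≤ (1 - r)⁻¹ := by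
  have hr0 : 0 < r := (Real.exp_pos _).trans_le hr
  cases a
  · exact (sum_exp_neg_separable_le hc hθ hr hr1).trans
      ((one_le_inv₀ (by linarith)).2 (by linarith))
  · refine le_trans ?_ (sum_exp_neg_subsetCost_le (α := Fin n × Fin K) hθ hr (by linarith))
    refine (Finset.sum_le_sum_of_subset_of_nonneg (Finset.subset_univ _)
      fun _ _ _ => by positivity).trans (Finset.sum_le_sum fun J _ => Real.exp_le_exp.2 ?_)
    have := sizeCost_nonneg .nonseparable c
    simp only [suppCost, Fintype.card_prod, Fintype.card_fin, Nat.cast_mul]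
    linarith

end Complexity

section Oracle

/-! ### Feasible points in the original order of the nodes -/

theorem minor_eq_of_rank_le_one {m m' : Type*} [Fintype m] [Fintype m']
    {M : Matrix m m' ℝ} (h : M.rank ≤ 1) (i i' : m) (j j' : m') :
    M i j * M i' j' = M i j' * M i' j := by
  classical
  obtain ⟨v, hv⟩ := finrank_le_one_iff.1 (show Module.finrank ℝ (LinearMap.range M.mulVecLin) ≤ 1
    from h)
  have hcol : ∀ j, ∃ t : ℝ, ∀ i, M i j = t * v.1 i := by
    intro j
    obtain ⟨t, ht⟩ := hv ⟨M.mulVecLin (Pi.single j 1), LinearMap.mem_range_self _ _⟩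
    refine ⟨t, fun i => ?_⟩
    have := congrFun (congrArg Subtype.val ht) i
    simpa using this.symm
  obtain ⟨t, ht⟩ := hcol j
  obtain ⟨t', ht'⟩ := hcol j'
  rw [ht, ht, ht', ht']
  ring

variable {n K : ℕ} {c : Fin n → Fin K} {J : Finset (Fin n × Fin K)}

theorem Feasible.estimator_eq_block (s : Feasible n) {i j : Fin n} {k l : Fin s.K}
    (hi : s.c i = k) (hj : s.c j = l) :
    s.estimator i j = block s.Theta k l ⟨i, hi⟩ ⟨j, hj⟩ := by
  subst hi hj
  rfl

theorem Feasible.estimator_ne_zero_iff (s : Feasible n) (i j : Fin n) :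
    s.estimator i j ≠ 0 ↔ (i, s.c j) ∈ s.J ∧ (j, s.c i) ∈ s.J := by
  rw [s.estimator_eq_block rfl rfl, s.supp_eq]
  simp [suppSet]

theorem Feasible.estimator_mem (s : Feasible n) : s.estimator ∈ rankOneClass s.c s.J := by
  refine ⟨fun i j i' j' hi hj => ?_, fun i j h => ?_⟩
  · rw [s.estimator_eq_block hi hj, s.estimator_eq_block (i := i') rfl (j := j') rfl,
      s.estimator_eq_block hi (j := j') rfl, s.estimator_eq_block (i := i') rfl hj]
    exact minor_eq_of_rank_le_one (s.rank_le_one _ _) _ _ _ _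
  · by_contra h0
    exact h ((s.estimator_ne_zero_iff i j).1 h0)

theorem sum_rearranged (c : Fin n → Fin K) (f : Fin n → ℝ) :
    ∑ k, ∑ i : Community c k, f i.1 = ∑ i, f i := by
  rw [← (perm c).sum_comp f, Fintype.sum_sigma]
  rfl

theorem objective_eq (a : PenaltyKind) (β₁ β₂ : ℝ) (A : Matrix (Fin n) (Fin n) ℝ)
    (s : Feasible n) :
    objective a β₁ β₂ A s = frobSq (A - s.estimator) + pen a β₁ β₂ s.c s.J := by
  rw [objective]
  congr 1
  rw [frobSq, ← sum_rearranged s.c]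
  refine Finset.sum_congr rfl fun k _ => ?_
  simp only [frobSq]
  rw [Finset.sum_comm]
  refine Finset.sum_congr rfl fun i _ => ?_
  rw [← sum_rearranged s.c]
  refine Finset.sum_congr rfl fun l _ => Finset.sum_congr rfl fun j _ => ?_
  rw [Matrix.sub_apply, Matrix.sub_apply, s.estimator_eq_block i.2 j.2]
  rfl

/-- The true connection probabilities as a feasible point. -/
noncomputable def trueFeasible (c : Fin n → Fin K) (hc : Function.Surjective c)
    (Lam : Matrix (Fin n) (Fin K) ℝ) : Feasible n where
  K := K
  c := c
  surj := hc
  J := trueSupp Lam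
  Theta := rearrange c (probMatrix c Lam)
  rank_le_one k l := by
    have : block (rearrange c (probMatrix c Lam)) k l =
        Matrix.vecMulVec (fun i : Community c k => Lam i.1 l)
          (fun j : Community c l => Lam j.1 k) := by
      ext ⟨i, rfl⟩ ⟨j, rfl⟩
      rfl
    rw [this]
    exact Matrix.rank_vecMulVec_le _ _
  supp_eq k l := by
    rintro ⟨i, rfl⟩ ⟨j, rfl⟩
    have : block (rearrange c (probMatrix c Lam)) (c i) (c j) ⟨i, rfl⟩ ⟨j, rfl⟩ =
        Lam i (c j) * Lam j (c i) := rfl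
    rw [this]
    simp [suppSet, trueSupp]

theorem trueFeasible_estimator (c : Fin n → Fin K) (hc : Function.Surjective c)
    (Lam : Matrix (Fin n) (Fin K) ℝ) :
    (trueFeasible c hc Lam).estimator = probMatrix c Lam := by
  ext i j
  rfl

theorem frobSq_sub_sub (A T P : Matrix (Fin n) (Fin n) ℝ) :
    frobSq (A - T) = frobSq (A - P) - 2 * frobInner (A - P) (T - P) + frobSq (T - P) := by
  simp only [frobSq, frobInner, Finset.mul_sum]
  rw [← Finset.sum_sub_distrib, ← Finset.sum_add_distrib]
  refine Finset.sum_congr rfl fun i _ => ?_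
  rw [← Finset.sum_sub_distrib, ← Finset.sum_add_distrib]
  refine Finset.sum_congr rfl fun j _ => ?_
  simp only [Matrix.sub_apply]
  ring

/-- The basic inequality for a minimizer of the penalized criterion. -/
theorem IsSolution.basic_inequality {a : PenaltyKind} {β₁ β₂ : ℝ}
    {A : Matrix (Fin n) (Fin n) ℝ} {s : Feasible n} (hs : IsSolution a β₁ β₂ A s)
    (hc : Function.Surjective c) (Lam : Matrix (Fin n) (Fin K) ℝ) :
    frobSq (s.estimator - probMatrix c Lam) + pen a β₁ β₂ s.c s.J ≤
      2 * frobInner (A - probMatrix c Lam) (s.estimator - probMatrix c Lam) +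
        pen a β₁ β₂ c (trueSupp Lam) := by
  have h := hs (trueFeasible c hc Lam)
  rw [objective_eq, objective_eq, trueFeasible_estimator,
    frobSq_sub_sub A s.estimator (probMatrix c Lam)] at h
  have h' : pen a β₁ β₂ (trueFeasible c hc Lam).c (trueFeasible c hc Lam).J =
    pen a β₁ β₂ c (trueSupp Lam) := rfl
  rw [h'] at h
  linarith

/-! ### Splitting off the blocks with a single entry -/

open Classical in
/-- The matrix `T` with the blocks that have a single entry set to zero. -/
noncomputable def dropSingles (c : Fin n → Fin K) (T : Matrix (Fin n) (Fin n) ℝ) :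
    Matrix (Fin n) (Fin n) ℝ :=
  Matrix.of fun i j => if SinglePair c (c i) (c j) then 0 else T i j

theorem dropSingles_mem {T : Matrix (Fin n) (Fin n) ℝ} (hT : T ∈ rankOneClass c J) :
    dropSingles c T ∈ rankOneClass c (reducedSupp c J) := by
  refine ⟨fun i j i' j' hi hj => ?_, fun i j h => ?_⟩
  · simp only [dropSingles, Matrix.of_apply]
    by_cases hs : SinglePair c (c i) (c j)
    · have hs' : SinglePair c (c i) (c j') := hj ▸ hs
      simp [hs, hs']
    · have h1 : ¬ SinglePair c (c i) (c j') := hj ▸ hs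
      have h2 : ¬ SinglePair c (c i') (c j) := hi ▸ hs
      have h3 : ¬ SinglePair c (c i') (c j') := hi ▸ h1
      simpa [hs, h1, h2, h3] using hT.1 i j i' j' hi hj
  · simp only [dropSingles, Matrix.of_apply]
    split_ifs with hs
    · rfl
    · refine hT.2 i j fun hJ => h ?_
      simp only [reducedSupp, Finset.mem_filter]
      exact ⟨⟨hJ.1, hs⟩, hJ.2, fun hs' => hs ⟨hs'.2, hs'.1⟩⟩

theorem eq_of_commSize_eq_one {i j : Fin n} (h : commSize c (c i) = 1) (hij : c i = c j) :
    i = j := by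
  obtain ⟨x, hx⟩ := Fintype.card_eq_one_iff.1 h
  have h1 := hx ⟨i, rfl⟩
  have h2 := hx ⟨j, hij.symm⟩
  exact congrArg Subtype.val (h1.trans h2.symm)

-- The map (i, j) ↦ (i, c j) sends these entries into J, injectively because the community of j is a
-- single node.
open Classical in
theorem sum_singles_le_card {T : Matrix (Fin n) (Fin n) ℝ} (hT : T ∈ rankOneClass c J) :
    ∑ i, ∑ j, (if SinglePair c (c i) (c j) ∧ T i j ≠ 0 then (1 : ℝ) else 0) ≤ J.card := by
  rw [← Fintype.sum_prod_type' (f := fun i j =>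
    if SinglePair c (c i) (c j) ∧ T i j ≠ 0 then (1 : ℝ) else 0), Finset.sum_boole]
  refine Nat.cast_le.2 (Finset.card_le_card_of_injOn (fun p => (p.1, c p.2)) ?_ ?_)
  · intro p hp
    have hp' := (Finset.mem_filter.1 hp).2.2
    by_contra h
    exact hp' (hT.2 _ _ fun h' => h h'.1)
  · intro p hp q hq h
    have hp' := (Finset.mem_filter.1 hp).2.1
    simp only [Prod.mk.injEq] at h
    exact Prod.ext h.1 (eq_of_commSize_eq_one hp'.2 h.2)

theorem frobSq_dropSingles_sub_le {T P : Matrix (Fin n) (Fin n) ℝ} (hT : T ∈ rankOneClass c J)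
    (hP : ∀ i j, P i j ∈ Set.Icc (0 : ℝ) 1) :
    frobSq (dropSingles c T - P) ≤ frobSq (T - P) + J.card := by
  classical
  refine le_trans ?_ (add_le_add_right (sum_singles_le_card hT) _)
  simp only [frobSq, ← Finset.sum_add_distrib]
  refine Finset.sum_le_sum fun i _ => Finset.sum_le_sum fun j _ => ?_
  simp only [Matrix.sub_apply, dropSingles, Matrix.of_apply]
  obtain ⟨h0, h1⟩ := hP i j
  by_cases hs : SinglePair c (c i) (c j)
  · by_cases ht : T i j = 0
    · simp [hs, ht]
    · simp only [hs, ht, if_true, ne_eq, not_false_eq_true, and_self]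
      nlinarith [sq_nonneg (T i j - P i j)]
  · simp [hs]

/-- No probability is needed here: each removed entry contributes 2ET = 2E(T - P) + 2EP, where the
first term is split by Young's inequality and the second is at most 2. -/
theorem two_mul_frobInner_singles_le {E T P : Matrix (Fin n) (Fin n) ℝ}
    (hT : T ∈ rankOneClass c J) (hP : ∀ i j, P i j ∈ Set.Icc (0 : ℝ) 1)
    (hE : ∀ i j, |E i j| ≤ 1) {α : ℝ} (hα : 0 < α) :
    2 * frobInner E (T - dropSingles c T) ≤ α * frobSq (T - P) + (1 / α + 2) * J.card := by
  classical
  refine le_trans ?_ (add_le_add_right (mul_le_mul_of_nonneg_left (sum_singles_le_card hT)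
    (by positivity)) _)
  simp only [frobSq, frobInner, Finset.mul_sum, ← Finset.sum_add_distrib]
  refine Finset.sum_le_sum fun i _ => Finset.sum_le_sum fun j _ => ?_
  simp only [Matrix.sub_apply, dropSingles, Matrix.of_apply]
  obtain ⟨h0, h1⟩ := hP i j
  have hD : 0 ≤ α * (T i j - P i j) ^ 2 := by positivity
  by_cases hs : SinglePair c (c i) (c j)
  · by_cases ht : T i j = 0
    · simp [hs, ht]; positivity
    · simp only [hs, ht, if_true, ne_eq, not_false_eq_true, and_self, sub_zero, mul_one]
      obtain ⟨e1, e2⟩ := abs_le.1 (hE i j)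
      have h2 : 2 * (E i j * (T i j - P i j)) ≤ α * (T i j - P i j) ^ 2 + 1 / α := by
        have h3 : 0 ≤ (α * (T i j - P i j) - E i j) ^ 2 / α := by positivity
        have h4 : (α * (T i j - P i j) - E i j) ^ 2 / α =
          α * (T i j - P i j) ^ 2 - 2 * (E i j * (T i j - P i j)) + E i j ^ 2 / α := by
          field_simp; ring
        have h5 : E i j ^ 2 / α ≤ 1 / α := by gcongr; nlinarith
        linarith
      have h3 : E i j * P i j ≤ 1 := by nlinarith
      nlinarith
  · simp only [hs, if_false, false_and, sub_self, mul_zero, add_zero]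
    exact hD

/-! ### The noise term at the selected model and the oracle inequality. -/

theorem two_mul_sqrt_mul_sqrt_le {x y α : ℝ} (hx : 0 ≤ x) (hy : 0 ≤ y) (hα : 0 < α) :
    2 * (√x * √y) ≤ α * x + y / α := by
  have h : 0 ≤ (α * √x - √y) ^ 2 / α := by positivity
  have h' : (α * √x - √y) ^ 2 / α = α * √x ^ 2 - 2 * (√x * √y) + √y ^ 2 / α := by
    field_simp; ring
  rw [h', Real.sq_sqrt hx, Real.sq_sqrt hy] at h
  linarith

theorem frobSq_sub_le (T T' P : Matrix (Fin n) (Fin n) ℝ) :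
    frobSq (T - T') ≤ 2 * frobSq (T - P) + 2 * frobSq (T' - P) := by
  simp only [frobSq, Finset.mul_sum, ← Finset.sum_add_distrib]
  refine Finset.sum_le_sum fun i _ => Finset.sum_le_sum fun j _ => ?_
  simp only [Matrix.sub_apply]
  nlinarith [sq_nonneg (T i j + T' i j - 2 * P i j)]

/-- The best approximation of `P` in the class of matrices with rank-one blocks. -/
noncomputable def nearest (c : Fin n → Fin K) (J : Finset (Fin n × Fin K))
    (P : Matrix (Fin n) (Fin n) ℝ) : Matrix (Fin n) (Fin n) ℝ :=
  (exists_nearest_rankOneClass c J P).choose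

theorem nearest_mem (c : Fin n → Fin K) (J : Finset (Fin n × Fin K))
    (P : Matrix (Fin n) (Fin n) ℝ) : nearest c J P ∈ rankOneClass c J :=
  (exists_nearest_rankOneClass c J P).choose_spec.1

theorem frobSq_nearest_sub_le (P : Matrix (Fin n) (Fin n) ℝ) {T : Matrix (Fin n) (Fin n) ℝ}
    (hT : T ∈ rankOneClass c J) : frobSq (nearest c J P - P) ≤ frobSq (T - P) :=
  (exists_nearest_rankOneClass c J P).choose_spec.2 T hT

/-- The noise is controlled at the support `J`, up to the levels `x₁` and `x₂`. -/
def NoiseControlled (c : Fin n → Fin K) (J : Finset (Fin n × Fin K))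
    (P E : Matrix (Fin n) (Fin n) ℝ) (x₁ x₂ : ℝ) : Prop :=
  frobInner E (nearest c J P - P) ≤ √(frobSq (nearest c J P - P)) * √x₁ ∧
    ∀ z ∈ latticeNet J, ∀ z' ∈ latticeNet J, frobInner E (latticeOuter c J z z') ≤
      √(frobSq (latticeOuter c J z z')) * √x₂

theorem two_mul_frobInner_le {E T P : Matrix (Fin n) (Fin n) ℝ} {x₁ x₂ α₁ α₂ : ℝ}
    (hE : ∀ i j, |E i j| ≤ 1) (hP : ∀ i j, P i j ∈ Set.Icc (0 : ℝ) 1)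
    (hT : T ∈ rankOneClass c J) (hx₁ : 0 ≤ x₁) (hx₂ : 0 ≤ x₂) (hα₁ : 0 < α₁) (hα₂ : 0 < α₂)
    (h : NoiseControlled c (reducedSupp c J) P E x₁ x₂) :
    2 * frobInner E (T - P) ≤ (α₁ + 5 * α₂) * frobSq (T - P) +
      (α₁ + 4 * α₂ + 1 / α₂ + 2) * J.card + x₁ / α₁ + 64 * x₂ / α₂ := by
  set T₀ := nearest c (reducedSupp c J) P with hT₀
  set U := dropSingles c T with hU
  have hUmem := dropSingles_mem hT
  have hUP := frobSq_dropSingles_sub_le hT hP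
  have h0P := (frobSq_nearest_sub_le P hUmem).trans hUP
  have hU0 := frobSq_sub_le U T₀ P
  have e1 := h.1
  have e2 := frobInner_sub_le_of_lattice (Real.sqrt_nonneg x₂) h.2 hUmem
    (nearest_mem c (reducedSupp c J) P)
  have e3 := two_mul_frobInner_singles_le hT hP hE hα₂
  have s1 := two_mul_sqrt_mul_sqrt_le (frobSq_nonneg (T₀ - P)) hx₁ hα₁
  have s2 := two_mul_sqrt_mul_sqrt_le (frobSq_nonneg (U - T₀))
    (by positivity : (0 : ℝ) ≤ 64 * x₂) hα₂
  have h8 : √(64 * x₂) = 8 * √x₂ := by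
    rw [Real.sqrt_mul (by norm_num), show (64 : ℝ) = 8 ^ 2 by norm_num,
      Real.sqrt_sq (by norm_num)]
  rw [h8] at s2
  -- The three parts are the stochastic error within the class, the removed entries and the
  -- nonrandom approximation error.
  have hsplit : frobInner E (T - P) =
      frobInner E (U - T₀) + frobInner E (T - U) + frobInner E (T₀ - P) := by
    rw [← frobInner_add, ← frobInner_add]
    congr 1
    abel
  have m1 := mul_le_mul_of_nonneg_left h0P hα₁.le
  -- Both `U` and `T₀` are within ‖T - P‖² + |J| of P in squared norm. Together with the removed
  -- entries this makes 5α₂.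
  have m2 : α₂ * frobSq (U - T₀) ≤ α₂ * (4 * (frobSq (T - P) + J.card)) :=
    mul_le_mul_of_nonneg_left (by linarith) hα₂.le
  rw [hsplit]
  linarith

/-- The oracle inequality on the event that the noise is controlled at the selected support. -/
theorem oracle_of_noiseControlled {a : PenaltyKind} {α₁ α₂ t : ℝ} (hα₁ : 0 < α₁) (hα₂ : 0 < α₂)
    (hα : α₁ + 8 * α₂ < 1) (ht : 0 ≤ t) {A : Matrix (Fin n) (Fin n) ℝ}
    (hA : ∀ i j, A i j = 0 ∨ A i j = 1) (hc : Function.Surjective c)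
    {Lam : Matrix (Fin n) (Fin K) ℝ} (hLam : ∀ i l, Lam i l ∈ Set.Icc (0 : ℝ) 1)
    {s : Feasible n}
    (hs : IsSolution a (betaOne 420 64 α₁ α₂) (betaTwo 64 α₁ α₂) A s)
    (h : NoiseControlled s.c (reducedSupp s.c s.J) (probMatrix c Lam) (A - probMatrix c Lam)
      (t + 2 * suppCost a s.c (reducedSupp s.c s.J) +
        2 * (sizeCost a s.c + clusterCost n s.K))
      (t + 3 * suppCost a s.c (reducedSupp s.c s.J) + 12 * (reducedSupp s.c s.J).card +
        2 * (sizeCost a s.c + clusterCost n s.K))) :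
    frobSq (s.estimator - probMatrix c Lam) ≤
      hZero α₁ α₂ * pen a (betaOne 420 64 α₁ α₂) (betaTwo 64 α₁ α₂) c (trueSupp Lam) +
        cTilde 64 α₁ α₂ * t := by
  set P := probMatrix c Lam with hPdef
  have hP : ∀ i j, P i j ∈ Set.Icc (0 : ℝ) 1 := fun i j =>
    ⟨mul_nonneg (hLam _ _).1 (hLam _ _).1, mul_le_one₀ (hLam _ _).2 (hLam _ _).1 (hLam _ _).2⟩
  have hE : ∀ i j, |(A - P) i j| ≤ 1 := by
    intro i j
    obtain ⟨h0, h1⟩ := hP i j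
    rw [Matrix.sub_apply, abs_le]
    rcases hA i j with h | h <;> rw [h] <;> constructor <;> linarith
  have hsub : reducedSupp s.c s.J ⊆ s.J := reducedSupp_subset s.c s.J
  have hG := suppCost_mono a s.c hsub
  have hJ := card_le_suppCost a s.c s.J
  have hJ' := card_le_suppCost a s.c (reducedSupp s.c s.J)
  set G := suppCost a s.c s.J with hGdef
  set G' := suppCost a s.c (reducedSupp s.c s.J) with hG'def
  set F := sizeCost a s.c + clusterCost n s.K with hFdef
  have hF : 0 ≤ F := add_nonneg (sizeCost_nonneg _ _) (clusterCost_nonneg _ _)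
  have hm : (0 : ℝ) ≤ s.J.card := Nat.cast_nonneg _
  have hm' : (0 : ℝ) ≤ (reducedSupp s.c s.J).card := Nat.cast_nonneg _
  have hb := hs.basic_inequality hc Lam
  rw [pen_eq a _ _ s.c s.J] at hb
  have h2 := two_mul_frobInner_le hE hP s.estimator_mem (by linarith) (by linarith) hα₁ hα₂ h
  set D := frobSq (s.estimator - P) with hD
  have hD0 : 0 ≤ D := frobSq_nonneg _
  have hi1 : 0 < 1 / α₁ := by positivity
  -- Lets α₁ + 4α₂ + 2 be absorbed into 1/α₂ below.
  have hi2 : 8 < 1 / α₂ := by rw [lt_div_iff₀ hα₂]; linarith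
  have x1 : (t + 2 * G' + 2 * F) / α₁ ≤ (1 / α₁) * (t + 2 * G + 2 * F) := by
    rw [div_eq_mul_one_div, mul_comm]
    gcongr
  have x2 : 64 * (t + 3 * G' + 12 * (reducedSupp s.c s.J).card + 2 * F) / α₂ ≤
      (1 / α₂) * (64 * (t + 15 * G + 2 * F)) := by
    rw [div_eq_mul_one_div, mul_comm]
    refine mul_le_mul_of_nonneg_left ?_ (by positivity)
    linarith
  have x3 : (α₁ + 4 * α₂ + 1 / α₂ + 2) * s.J.card ≤ (1 / α₂) * (2 * G) := by
    calc _ ≤ (2 * (1 / α₂)) * (s.J.card : ℝ) := by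
          gcongr
          linarith
      _ ≤ (2 * (1 / α₂)) * G := by gcongr
      _ = _ := by ring
  -- The needed coefficient of G/α₂ is 64·(3 + 12) + 2 = 962, below 968 = 2(420 + 64); that of F/α₂
  -- is 2·64 = 128. Here 64 is the square of the discretization factor 8.
  have hβ₁ : betaOne 420 64 α₁ α₂ = 968 * (1 / α₂) + 968 + 2 * (1 / α₁) := by
    rw [betaOne]; field_simp; ring
  have hβ₂ : betaTwo 64 α₁ α₂ = 128 * (1 / α₂) + 128 + 2 * (1 / α₁) := by
    rw [betaTwo]; field_simp; ring
  set Q := pen a (betaOne 420 64 α₁ α₂) (betaTwo 64 α₁ α₂) c (trueSupp Lam) with hQ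
  replace hb : D + (betaOne 420 64 α₁ α₂ * G + betaTwo 64 α₁ α₂ * F) ≤
    2 * frobInner (A - P) (s.estimator - P) + Q := hb
  have hG0 : 0 ≤ G := hm.trans hJ
  have key : (1 - α₁ - 8 * α₂) * D ≤ Q + 2 * (64 + 1 / α₁ + 64 / α₂) * t := by
    rw [hβ₁, hβ₂] at hb
    have y1 : 0 ≤ (1 / α₂) * G := by positivity
    have y2 : 0 ≤ (1 / α₂) * F := by positivity
    have y3 : 0 ≤ (1 / α₂) * t := by positivity
    have y4 : 0 ≤ (1 / α₁) * t := by positivity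
    have y5 : 0 ≤ α₂ * D := by positivity
    have y6 : 64 / α₂ = 64 * (1 / α₂) := by ring
    rw [y6]
    nlinarith
  have hpos : 0 < 1 - α₁ - 8 * α₂ := by linarith
  rw [hZero, cTilde, hZero]
  calc D ≤ (1 - α₁ - 8 * α₂)⁻¹ * (Q + 2 * (64 + 1 / α₁ + 64 / α₂) * t) := by
        rw [inv_mul_eq_div, le_div_iff₀ hpos, mul_comm]
        exact key
    _ = _ := by ring

end Oracle

section Deviation

/-! ### The noise is controlled at all supports simultaneously -/

variable {n K : ℕ} {c : Fin n → Fin K} {J : Finset (Fin n × Fin K)}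

theorem IsBernoulliNetwork.measureReal_not_noiseControlled_le {Ω : Type*} [MeasurableSpace Ω]
    {μ : Measure Ω} [IsProbabilityMeasure μ] {A : Ω → Matrix (Fin n) (Fin n) ℝ}
    {P : Matrix (Fin n) (Fin n) ℝ} (hA : IsBernoulliNetwork μ A P)
    (hP : ∀ i j, P i j = P j i) (c : Fin n → Fin K) (J : Finset (Fin n × Fin K)) {x₁ x₂ : ℝ}
    (hx₁ : 0 ≤ x₁) (hx₂ : 0 ≤ x₂) :
    μ.real {ω | ¬ NoiseControlled c J P (A ω - P) x₁ x₂} ≤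
      Real.exp (-x₁) + Real.exp (12 * J.card - x₂) := by
  have hsub : {ω | ¬ NoiseControlled c J P (A ω - P) x₁ x₂} ⊆
      {ω | √(frobSq (nearest c J P - P)) * √x₁ < frobInner (A ω - P) (nearest c J P - P)} ∪
      ⋃ z ∈ latticeNet J, ⋃ z' ∈ latticeNet J, {ω | √(frobSq (latticeOuter c J z z')) * √x₂ <
        frobInner (A ω - P) (latticeOuter c J z z')} := by
    intro ω hω
    by_contra h
    refine hω ⟨?_, fun z hz z' hz' => ?_⟩
    · by_contra h1
      exact h (Or.inl (not_le.1 h1))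
    · by_contra h1
      exact h (Or.inr (Set.mem_biUnion hz (Set.mem_biUnion hz' (not_le.1 h1))))
  refine (measureReal_mono hsub).trans ((measureReal_union_le _ _).trans
    (add_le_add (hA.tail_frobInner hP _ hx₁) ?_))
  calc _ ≤ ∑ z ∈ latticeNet J, ∑ z' ∈ latticeNet J, Real.exp (-x₂) := by
        refine (measureReal_biUnion_finset_le _ _).trans (Finset.sum_le_sum fun z _ => ?_)
        exact (measureReal_biUnion_finset_le _ _).trans
          (Finset.sum_le_sum fun z' _ => hA.tail_frobInner hP _ hx₂)
    _ = ((latticeNet J).card : ℝ) * ((latticeNet J).card * Real.exp (-x₂)) := by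
        simp [Finset.sum_const]
    _ ≤ Real.exp (6 * J.card) * (Real.exp (6 * J.card) * Real.exp (-x₂)) := by
        have := card_latticeNet_le J
        gcongr
    _ = Real.exp (12 * J.card - x₂) := by
        rw [← Real.exp_add, ← Real.exp_add]
        ring_nf

theorem exp_neg_clusterCost (hn : 1 ≤ n) (hK : 1 ≤ K) :
    Real.exp (-(2 * clusterCost n K)) = ((K : ℝ) ^ n)⁻¹ ^ 2 * (n : ℝ)⁻¹ ^ 2 := by
  have hn0 : (0 : ℝ) < n := by exact_mod_cast hn
  have hK0 : (0 : ℝ) < K := by exact_mod_cast hK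
  rw [clusterCost, show -(2 * ((n : ℝ) * Real.log K + Real.log n)) =
    (2 : ℕ) * -(n * Real.log K) + (2 : ℕ) * -Real.log n by push_cast; ring, Real.exp_add,
    Real.exp_nat_mul, Real.exp_nat_mul, Real.exp_neg, Real.exp_neg, Real.exp_log hn0,
    Real.exp_nat_mul, Real.exp_log hK0]

/-- The deviation level for the approximation error at the support `J`. -/
noncomputable def biasLevel (a : PenaltyKind) (t : ℝ) (c : Fin n → Fin K)
    (J : Finset (Fin n × Fin K)) : ℝ :=
  t + 2 * suppCost a c J + 2 * (sizeCost a c + clusterCost n K)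

/-- The deviation level for the estimation error at the support `J`. -/
noncomputable def estimationLevel (a : PenaltyKind) (t : ℝ) (c : Fin n → Fin K)
    (J : Finset (Fin n × Fin K)) : ℝ :=
  t + 3 * suppCost a c J + 12 * J.card + 2 * (sizeCost a c + clusterCost n K)

theorem IsBernoulliNetwork.measureReal_iUnion_not_noiseControlled_le {Ω : Type*}
    [MeasurableSpace Ω] {μ : Measure Ω} [IsProbabilityMeasure μ]
    {A : Ω → Matrix (Fin n) (Fin n) ℝ} {P : Matrix (Fin n) (Fin n) ℝ}
    (hA : IsBernoulliNetwork μ A P) (hP : ∀ i j, P i j = P j i) (a : PenaltyKind)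
    (hc : Function.Surjective c) {t : ℝ} (ht : 0 ≤ t) :
    μ.real (⋃ J ∈ reducedSupps c, {ω | ¬ NoiseControlled c J P (A ω - P) (biasLevel a t c J)
      (estimationLevel a t c J)}) ≤ Real.exp (-t) * Real.exp (-(2 * clusterCost n K)) * 3 := by
  have hF := sizeCost_nonneg a c
  have hC := clusterCost_nonneg n K
  calc _ ≤ ∑ J ∈ reducedSupps c, Real.exp (-t) * Real.exp (-(2 * clusterCost n K)) *
        (Real.exp (-(2 * suppCost a c J) - 2 * sizeCost a c) +
          Real.exp (-(3 * suppCost a c J) - 2 * sizeCost a c)) := by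
        refine (measureReal_biUnion_finset_le _ _).trans (Finset.sum_le_sum fun J _ => ?_)
        have hJ : (0 : ℝ) ≤ J.card := Nat.cast_nonneg _
        have hG := hJ.trans (card_le_suppCost a c J)
        refine (hA.measureReal_not_noiseControlled_le hP c J
          (by rw [biasLevel]; positivity) (by rw [estimationLevel]; positivity)).trans
          (le_of_eq ?_)
        rw [mul_add, ← Real.exp_add, ← Real.exp_add, ← Real.exp_add, biasLevel, estimationLevel]
        congr 2 <;> ring
    -- The multiples 2 and 3 of the support cost give ratios e⁻¹ ≤ 3/8 and e⁻² ≤ 1/6, so the total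
    -- is 8/5 + 6/5 ≤ 3.
    _ ≤ Real.exp (-t) * Real.exp (-(2 * clusterCost n K)) *
        ((1 - 3 / 8)⁻¹ + (1 - 1 / 6)⁻¹) := by
        rw [← Finset.mul_sum, Finset.sum_add_distrib]
        have he := Real.exp_one_gt_d9
        have h1 : Real.exp (-1) ≤ 3 / 8 := by
          rw [Real.exp_neg, inv_le_comm₀ (Real.exp_pos _) (by norm_num)]
          linarith
        gcongr
        · refine sum_exp_neg_cost_le a hc (by norm_num) ?_ (by norm_num)
          norm_num
          exact h1
        · refine sum_exp_neg_cost_le a hc (by norm_num) ?_ (by norm_num)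
          rw [show -((3 : ℝ) - 1) = -1 + -1 by norm_num, Real.exp_add]
          nlinarith [Real.exp_pos (-1)]
    _ ≤ _ := by gcongr; norm_num

/-- Outside an event of probability at most `3 e⁻ᵗ` the noise is controlled at all supports. -/
theorem IsBernoulliNetwork.exists_noiseControlled {Ω : Type*} [MeasurableSpace Ω]
    {μ : Measure Ω} [IsProbabilityMeasure μ] {A : Ω → Matrix (Fin n) (Fin n) ℝ}
    {P : Matrix (Fin n) (Fin n) ℝ} (hA : IsBernoulliNetwork μ A P) (hn : 1 ≤ n)
    (hP : ∀ i j, P i j = P j i) (a : PenaltyKind) {t : ℝ} (ht : 0 ≤ t) :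
    ∃ B : Set Ω, μ.real B ≤ 3 * Real.exp (-t) ∧ ∀ ω ∉ B, ∀ (K : ℕ) (c : Fin n → Fin K),
      Function.Surjective c → ∀ J ∈ reducedSupps c,
        NoiseControlled c J P (A ω - P) (biasLevel a t c J) (estimationLevel a t c J) := by
  classical
  have hn1 : (1 : ℝ) ≤ n := by exact_mod_cast hn
  refine ⟨⋃ K ∈ Finset.Icc 1 n, ⋃ c ∈ (Finset.univ : Finset (Fin n → Fin K)).filter
    Function.Surjective, ⋃ J ∈ reducedSupps c, {ω | ¬ NoiseControlled c J P (A ω - P)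
      (biasLevel a t c J) (estimationLevel a t c J)}, ?_, fun ω hω K c hc J hJ => ?_⟩
  · calc _ ≤ ∑ K ∈ Finset.Icc 1 n, ∑ c ∈ (Finset.univ : Finset (Fin n → Fin K)).filter
          Function.Surjective, Real.exp (-t) * Real.exp (-(2 * clusterCost n K)) * 3 := by
          refine (measureReal_biUnion_finset_le _ _).trans (Finset.sum_le_sum fun K _ => ?_)
          refine (measureReal_biUnion_finset_le _ _).trans (Finset.sum_le_sum fun c hc => ?_)
          exact hA.measureReal_iUnion_not_noiseControlled_le hP a (Finset.mem_filter.1 hc).2 ht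
      _ ≤ ∑ K ∈ Finset.Icc 1 n, 3 * Real.exp (-t) * (n : ℝ)⁻¹ := by
          refine Finset.sum_le_sum fun K hK => ?_
          have hK1 := (Finset.mem_Icc.1 hK).1
          have hK0 : (1 : ℝ) ≤ K := by exact_mod_cast hK1
          have hcard : (((Finset.univ : Finset (Fin n → Fin K)).filter
              Function.Surjective).card : ℝ) ≤ (K : ℝ) ^ n := by
            have := Finset.card_filter_le (Finset.univ : Finset (Fin n → Fin K))
              Function.Surjective
            rw [Finset.card_univ, Fintype.card_fun, Fintype.card_fin, Fintype.card_fin] at this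
            exact_mod_cast this
          rw [Finset.sum_const, nsmul_eq_mul, exp_neg_clusterCost hn hK1]
          have hKn : (1 : ℝ) ≤ (K : ℝ) ^ n := one_le_pow₀ hK0
          -- The term n ln K of the clustering cost pays for at most Kⁿ clusterings, and ln n for
          -- the n possible values of K.
          have h1 : (K : ℝ) ^ n * ((K : ℝ) ^ n)⁻¹ ^ 2 ≤ 1 := by
            rw [pow_two, ← mul_assoc, mul_inv_cancel₀ (by positivity), one_mul]
            exact inv_le_one_of_one_le₀ hKn
          have h2 : (n : ℝ)⁻¹ ^ 2 ≤ (n : ℝ)⁻¹ :=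
            pow_le_of_le_one (by positivity) (inv_le_one_of_one_le₀ hn1) two_ne_zero
          calc _ ≤ (K : ℝ) ^ n * (Real.exp (-t) * (((K : ℝ) ^ n)⁻¹ ^ 2 * (n : ℝ)⁻¹ ^ 2) * 3) := by
                gcongr
            _ = 3 * Real.exp (-t) * (((K : ℝ) ^ n * ((K : ℝ) ^ n)⁻¹ ^ 2) * (n : ℝ)⁻¹ ^ 2) := by
                ring
            _ ≤ 3 * Real.exp (-t) * (1 * (n : ℝ)⁻¹) := by gcongr
            _ = _ := by ring
      _ = 3 * Real.exp (-t) := by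
          rw [Finset.sum_const, Nat.card_Icc, nsmul_eq_mul, Nat.add_sub_cancel]
          field_simp
  · by_contra h
    refine hω ?_
    have hK1 : 1 ≤ K := (Nat.zero_le _).trans_lt (c ⟨0, hn⟩).2
    have hKn : K ≤ n := by simpa using Fintype.card_le_of_surjective c hc
    exact Set.mem_biUnion (Finset.mem_coe.2 (Finset.mem_Icc.2 ⟨hK1, hKn⟩))
      (Set.mem_biUnion (Finset.mem_coe.2 (Finset.mem_filter.2 ⟨Finset.mem_univ c, hc⟩))
        (Set.mem_biUnion hJ h))

/-! ### From tails to expectations -/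

theorem lintegral_Ioi_three_mul_exp_neg :
    ∫⁻ t in Set.Ioi (0 : ℝ), ENNReal.ofReal (3 * Real.exp (-t)) = ENNReal.ofReal 3 := by
  rw [← ofReal_integral_eq_lintegral_ofReal
    ((integrableOn_exp_neg_Ioi 0).const_mul 3) (ae_of_all _ fun t => by positivity),
    integral_const_mul, integral_exp_neg_Ioi_zero, mul_one]

/-- An exponential tail bound yields integrability and a bound on the expectation. -/
theorem integrable_and_integral_le_of_tail {Ω : Type*} [MeasurableSpace Ω] {μ : Measure Ω}
    [IsProbabilityMeasure μ] {X : Ω → ℝ} (hX : AEMeasurable X μ) (hX0 : ∀ ω, 0 ≤ X ω)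
    {q C : ℝ} (hC : 0 < C)
    (h : ∀ t : ℝ, 0 < t → ∃ B : Set Ω, μ.real B ≤ 3 * Real.exp (-t) ∧
      ∀ ω ∉ B, X ω ≤ q + C * t) :
    Integrable X μ ∧ ∫ ω, X ω ∂μ ≤ q + 3 * C := by
  -- The normalized excess exceeds t with probability at most 3e⁻ᵗ, so the layer-cake formula bounds
  -- its mean by 3.
  set Y : Ω → ℝ := fun ω => max ((X ω - q) / C) 0 with hY
  have hYm : AEMeasurable Y μ := ((hX.sub_const q).div_const C).max aemeasurable_const
  have hY0 : ∀ ω, 0 ≤ Y ω := fun ω => le_max_right _ _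
  have hXY : ∀ ω, X ω ≤ q + C * Y ω := fun ω => by
    have : C * ((X ω - q) / C) ≤ C * Y ω := mul_le_mul_of_nonneg_left (le_max_left _ _) hC.le
    rw [mul_div_cancel₀ _ hC.ne'] at this
    linarith
  have hlint : ∫⁻ ω, ENNReal.ofReal (Y ω) ∂μ ≤ ENNReal.ofReal 3 := by
    rw [lintegral_eq_lintegral_meas_lt μ (ae_of_all _ hY0) hYm,
      ← lintegral_Ioi_three_mul_exp_neg]
    refine setLIntegral_mono' measurableSet_Ioi fun t ht => ?_
    obtain ⟨B, hB, hB'⟩ := h t ht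
    have hsub : {ω | t < Y ω} ⊆ B := by
      intro ω hω
      by_contra hωB
      have h1 := hB' ω hωB
      have h2 : (X ω - q) / C ≤ t := by rw [div_le_iff₀ hC]; linarith
      exact absurd (show t < max ((X ω - q) / C) 0 from hω) (not_lt.2 (max_le h2 (le_of_lt ht)))
    refine (measure_mono hsub).trans ?_
    rw [← ofReal_measureReal]
    exact ENNReal.ofReal_le_ofReal hB
  have hYint : Integrable Y μ := by
    refine ⟨hYm.aestronglyMeasurable, ?_⟩
    rw [hasFiniteIntegral_iff_ofReal (ae_of_all _ hY0)]
    exact hlint.trans_lt ENNReal.ofReal_lt_top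
  have hYle : ∫ ω, Y ω ∂μ ≤ 3 := by
    rw [integral_eq_lintegral_of_nonneg_ae (ae_of_all _ hY0) hYm.aestronglyMeasurable]
    exact ENNReal.toReal_le_of_le_ofReal (by norm_num) hlint
  have hqY : Integrable (fun ω => q + C * Y ω) μ := (integrable_const q).add (hYint.const_mul C)
  have hXint : Integrable X μ := hqY.mono' hX.aestronglyMeasurable (ae_of_all _ fun ω => by
    rw [Real.norm_of_nonneg (hX0 ω)]
    exact hXY ω)
  refine ⟨hXint, (integral_mono hXint hqY hXY).trans ?_⟩
  rw [integral_add (integrable_const q) (hYint.const_mul C), integral_const_mul]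
  simp only [integral_const, probReal_univ, smul_eq_mul, one_mul]
  nlinarith

/-! ### Comparison of the penalties with the rate -/

theorem sum_commSize (c : Fin n → Fin K) : ∑ k, (commSize c k : ℝ) = n := by
  have := sum_rearranged c fun _ => 1
  simpa [commSize] using this

/-- Concavity of the logarithm: each block is compared, through ln x ≤ x - 1, with the uniform
density |J|/(nK). The linear corrections cancel on summing, since ∑ n_k = n. -/
theorem suppCost_separable_le (c : Fin n → Fin K) (J : Finset (Fin n × Fin K)) :
    suppCost .separable c J ≤ suppCost .nonseparable c J := by
  rcases J.eq_empty_or_nonempty with rfl | hJ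
  · simp [suppCost, suppSet, subsetCost]
  obtain ⟨⟨i₀, l₀⟩, -⟩ := id hJ
  have hn : (0 : ℝ) < n := by exact_mod_cast (Nat.zero_le _).trans_lt i₀.2
  have hK : (0 : ℝ) < K := by exact_mod_cast (Nat.zero_le _).trans_lt l₀.2
  have hJ0 : (0 : ℝ) < J.card := by exact_mod_cast hJ.card_pos
  set ℓ := Real.log (n * K * Real.exp 1 / J.card) with hℓ
  have hterm : ∀ k l, subsetCost (commSize c k) (suppSet c J k l).card ≤
      (suppSet c J k l).card * ℓ + (commSize c k * (J.card / (n * K)) - (suppSet c J k l).card) := by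
    intro k l
    rcases Nat.eq_zero_or_pos (suppSet c J k l).card with h0 | h0
    · rw [h0]
      simp only [subsetCost, Nat.cast_zero, zero_mul, zero_add, sub_zero]
      positivity
    have hj : (0 : ℝ) < (suppSet c J k l).card := by exact_mod_cast h0
    have hk : (0 : ℝ) < commSize c k := by exact_mod_cast h0.trans_le (card_suppSet_le c J k l)
    generalize ((suppSet c J k l).card : ℝ) = j at hj ⊢
    have hsplit : Real.log (commSize c k * Real.exp 1 / j) =
        ℓ + Real.log (commSize c k * (J.card / (n * K)) / j) := by
      rw [hℓ, ← Real.log_mul (by positivity) (by positivity)]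
      congr 1
      field_simp
    have hlog := mul_le_mul_of_nonneg_left (Real.log_le_sub_one_of_pos
      (by positivity : 0 < commSize c k * (J.card / (n * K)) / j)) hj.le
    rw [mul_sub, mul_div_cancel₀ _ hj.ne', mul_one] at hlog
    rw [subsetCost, hsplit, mul_add]
    linarith
  refine (Finset.sum_le_sum fun k _ => Finset.sum_le_sum fun l _ => hterm k l).trans (le_of_eq ?_)
  simp only [Finset.sum_add_distrib, Finset.sum_sub_distrib, ← Finset.sum_mul]
  rw [← card_eq_sum_suppSet]
  simp only [Finset.sum_const, Finset.card_univ, Fintype.card_fin, nsmul_eq_mul,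
    ← Finset.mul_sum, suppCost, subsetCost]
  rw [sum_commSize, ← hℓ]
  field_simp
  ring

/-- The cost is at most K² ln n, hence at most n. For K ≥ 2 this is below 2n ln K because ln 2 ≥
1/2; for K ≤ 1 the term ln n suffices. -/
theorem sizeCost_separable_le (hn : 8 ≤ n) (hc : Function.Surjective c)
    (hK : (K : ℝ) ≤ √(n / Real.log n)) :
    sizeCost .separable c ≤ 2 * (n * Real.log K) + Real.log n := by
  have hn8 : (8 : ℝ) ≤ n := by exact_mod_cast hn
  have hlog : 0 < Real.log n := Real.log_pos (by linarith)
  have hsum : ∑ k, Real.log (commSize c k) ≤ K * Real.log n := by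
    calc _ ≤ ∑ _k : Fin K, Real.log n := by
          refine Finset.sum_le_sum fun k _ => Real.log_le_log
            (by exact_mod_cast commSize_pos hc k) ?_
          rw [← sum_commSize c]
          exact Finset.single_le_sum (f := fun k => (commSize c k : ℝ))
            (fun _ _ => Nat.cast_nonneg _) (Finset.mem_univ k)
      _ = _ := by simp
  have hK0 : (0 : ℝ) ≤ K := Nat.cast_nonneg K
  have hmul : sizeCost .separable c ≤ K * (K * Real.log n) :=
    mul_le_mul_of_nonneg_left hsum hK0
  rcases Nat.lt_or_ge K 2 with h | h
  · have hK1 : (K : ℝ) ≤ 1 := by exact_mod_cast Nat.lt_succ_iff.1 h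
    have h1 : K * (K * Real.log n) ≤ 1 * (1 * Real.log n) := by gcongr
    have h2 : 0 ≤ (n : ℝ) * Real.log K :=
      mul_nonneg n.cast_nonneg (Real.log_natCast_nonneg K)
    linarith
  · have hsq : (K : ℝ) ^ 2 ≤ n / Real.log n :=
      (Real.le_sqrt hK0 (by positivity)).1 hK
    rw [le_div_iff₀ hlog] at hsq
    have hlogK : 1 / 2 ≤ Real.log K := by
      have : Real.log 2 ≤ Real.log K := Real.log_le_log (by norm_num) (by exact_mod_cast h)
      linarith [Real.log_two_gt_d9]
    nlinarith

theorem rate_eq (c : Fin n → Fin K) (J : Finset (Fin n × Fin K)) :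
    rate J = suppCost .nonseparable c J + clusterCost n K := by
  simp only [rate, suppCost, subsetCost, clusterCost]
  ring

theorem suppCost_nonneg (a : PenaltyKind) (c : Fin n → Fin K) (J : Finset (Fin n × Fin K)) :
    0 ≤ suppCost a c J :=
  (Nat.cast_nonneg _).trans (card_le_suppCost a c J)

/-- Both penalties are comparable to the rate. -/
theorem exists_penalty_rate_bounds {β₁ β₂ : ℝ} (hβ₁ : 0 < β₁) (hβ₂ : 0 < β₂) :
    ∃ κ : ℝ, 0 < κ ∧ ∀ (n : ℕ), 1 ≤ n → ∀ (K : ℕ) (c : Fin n → Fin K), Function.Surjective c →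
      ∀ J : Finset (Fin n × Fin K),
        (κ⁻¹ * rate J ≤ pen .nonseparable β₁ β₂ c J ∧
          pen .nonseparable β₁ β₂ c J ≤ κ * rate J) ∧
        (8 ≤ n → (K : ℝ) ≤ √((n : ℝ) / Real.log (n : ℝ)) →
          pen .separable β₁ β₂ c J ≤ κ * rate J) := by
  have hi₁ : 0 < β₁⁻¹ := inv_pos.2 hβ₁
  have hi₂ : 0 < β₂⁻¹ := inv_pos.2 hβ₂
  -- The factor 3 covers 3β₂ ln n in the nonseparable penalty and 3β₂ n ln K in the bound for the
  -- separable one; the inverses serve the lower bound.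
  set κ := β₁ + 3 * β₂ + β₁⁻¹ + β₂⁻¹ with hκ
  have hκ0 : 0 < κ := by positivity
  have hκ₁ : κ⁻¹ ≤ β₁ := inv_le_of_inv_le₀ hβ₁ (by linarith)
  have hκ₂ : κ⁻¹ ≤ β₂ := inv_le_of_inv_le₀ hβ₂ (by linarith)
  refine ⟨κ, hκ0, fun n hn K c hc J => ?_⟩
  have hS := suppCost_nonneg .nonseparable c J
  have hL : 0 ≤ (n : ℝ) * Real.log K := mul_nonneg n.cast_nonneg (Real.log_natCast_nonneg K)
  have hl : 0 ≤ Real.log (n : ℝ) := Real.log_natCast_nonneg n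
  have hC : clusterCost n K = n * Real.log K + Real.log n := rfl
  have hZ : sizeCost .nonseparable c = 2 * Real.log n := rfl
  have hk₁ : β₁ ≤ κ := by linarith
  have hk₂ : 3 * β₂ ≤ κ := by linarith
  rw [rate_eq c, pen_eq, pen_eq, hZ, hC]
  have hsep := suppCost_separable_le c J
  generalize suppCost .nonseparable c J = S at *
  refine ⟨⟨?_, ?_⟩, fun hn8 hK => ?_⟩
  · nlinarith [mul_le_mul_of_nonneg_right hκ₁ hS, mul_le_mul_of_nonneg_right hκ₂ hL,
      mul_le_mul_of_nonneg_right hκ₂ hl, mul_nonneg hβ₂.le hl]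
  · nlinarith [mul_le_mul_of_nonneg_right hk₁ hS, mul_le_mul_of_nonneg_right hk₂ hL,
      mul_le_mul_of_nonneg_right hk₂ hl, mul_nonneg hβ₂.le hL]
  · have h1 := mul_le_mul_of_nonneg_left hsep hβ₁.le
    have h2 := mul_le_mul_of_nonneg_left (sizeCost_separable_le hn8 hc hK) hβ₂.le
    nlinarith [mul_le_mul_of_nonneg_right hk₁ hS, mul_le_mul_of_nonneg_right hk₂ hL,
      mul_le_mul_of_nonneg_right hk₂ hl, mul_nonneg hβ₂.le hl]

end Deviation

end SPABM

theorem theorem1 :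
    ∃ C₁ C₂ : ℝ, 0 < C₁ ∧ 0 < C₂ ∧ ∀ α₁ α₂ : ℝ, 0 < α₁ → 0 < α₂ → α₁ + 8 * α₂ < 1 →
      (∀ (a : SPABM.PenaltyKind) (n : ℕ), 1 ≤ n →
        ∀ (K : ℕ) (c : Fin n → Fin K), Function.Surjective c →
        ∀ Lam : Matrix (Fin n) (Fin K) ℝ, (∀ i l, Lam i l ∈ Set.Icc (0 : ℝ) 1) →
        ∀ (Ω : Type*) [MeasurableSpace Ω] (μ : MeasureTheory.Measure Ω)
          [MeasureTheory.IsProbabilityMeasure μ] (A : Ω → Matrix (Fin n) (Fin n) ℝ),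
          SPABM.IsBernoulliNetwork μ A (SPABM.probMatrix c Lam) →
        ∀ sol : Ω → SPABM.Feasible n,
          (∀ ω, SPABM.IsSolution a (SPABM.betaOne C₁ C₂ α₁ α₂) (SPABM.betaTwo C₂ α₁ α₂)
            (A ω) (sol ω)) →
          (∀ i j, AEMeasurable (fun ω => (sol ω).estimator i j) μ) →
          (∀ t : ℝ, 0 < t →
            1 - 3 * Real.exp (-t) ≤
              μ.real {ω | ((n : ℝ) ^ 2)⁻¹ *
                  SPABM.frobSq ((sol ω).estimator - SPABM.probMatrix c Lam) ≤
                ((n : ℝ) ^ 2)⁻¹ * (SPABM.hZero α₁ α₂ *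
                  SPABM.pen a (SPABM.betaOne C₁ C₂ α₁ α₂) (SPABM.betaTwo C₂ α₁ α₂)
                    c (SPABM.trueSupp Lam)) +
                ((n : ℝ) ^ 2)⁻¹ * (SPABM.cTilde C₂ α₁ α₂ * t)}) ∧
          MeasureTheory.Integrable
            (fun ω => SPABM.frobSq ((sol ω).estimator - SPABM.probMatrix c Lam)) μ ∧
          ((n : ℝ) ^ 2)⁻¹ *
              ∫ ω, SPABM.frobSq ((sol ω).estimator - SPABM.probMatrix c Lam) ∂μ ≤
            ((n : ℝ) ^ 2)⁻¹ * (SPABM.hZero α₁ α₂ *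
              SPABM.pen a (SPABM.betaOne C₁ C₂ α₁ α₂) (SPABM.betaTwo C₂ α₁ α₂)
                c (SPABM.trueSupp Lam)) +
            3 * ((n : ℝ) ^ 2)⁻¹ * SPABM.cTilde C₂ α₁ α₂) ∧
      (∃ κ : ℝ, 0 < κ ∧
        ∀ (n : ℕ), 1 ≤ n → ∀ (K : ℕ) (c : Fin n → Fin K), Function.Surjective c →
        ∀ J : Finset (Fin n × Fin K),
          (κ⁻¹ * SPABM.rate J ≤
              SPABM.pen .nonseparable (SPABM.betaOne C₁ C₂ α₁ α₂) (SPABM.betaTwo C₂ α₁ α₂) c J ∧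
            SPABM.pen .nonseparable (SPABM.betaOne C₁ C₂ α₁ α₂) (SPABM.betaTwo C₂ α₁ α₂) c J ≤
              κ * SPABM.rate J) ∧
          (8 ≤ n → (K : ℝ) ≤ Real.sqrt ((n : ℝ) / Real.log (n : ℝ)) →
            SPABM.pen .separable (SPABM.betaOne C₁ C₂ α₁ α₂) (SPABM.betaTwo C₂ α₁ α₂) c J ≤
              κ * SPABM.rate J)) := by
  refine ⟨420, 64, by norm_num, by norm_num, fun α₁ α₂ hα₁ hα₂ hα => ⟨?_, ?_⟩⟩
  · intro a n hn K c hc Lam hLam Ω _ μ _ A hA sol hsol hmeas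
    have hP : ∀ i j, SPABM.probMatrix c Lam i j = SPABM.probMatrix c Lam j i := fun i j =>
      mul_comm _ _
    have htail : ∀ t : ℝ, 0 < t → ∃ B : Set Ω, μ.real B ≤ 3 * Real.exp (-t) ∧ ∀ ω ∉ B,
        SPABM.frobSq ((sol ω).estimator - SPABM.probMatrix c Lam) ≤
          SPABM.hZero α₁ α₂ * SPABM.pen a (SPABM.betaOne 420 64 α₁ α₂) (SPABM.betaTwo 64 α₁ α₂)
            c (SPABM.trueSupp Lam) + SPABM.cTilde 64 α₁ α₂ * t := by
      intro t ht
      obtain ⟨B, hB, hgood⟩ := hA.exists_noiseControlled hn hP a ht.le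
      exact ⟨B, hB, fun ω hω => SPABM.oracle_of_noiseControlled hα₁ hα₂ hα ht.le
        (hA.zero_or_one ω) hc hLam (hsol ω) (hgood ω hω _ _ (sol ω).surj _
          (SPABM.reducedSupp_mem _ _))⟩
    have hC : 0 < SPABM.cTilde 64 α₁ α₂ := by
      have : 0 < SPABM.hZero α₁ α₂ := inv_pos.2 (by linarith)
      rw [SPABM.cTilde]
      positivity
    have hX : AEMeasurable (fun ω => SPABM.frobSq ((sol ω).estimator - SPABM.probMatrix c Lam))
        μ := by
      simp only [SPABM.frobSq, Matrix.sub_apply]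
      exact Finset.aemeasurable_fun_sum _ fun i _ => Finset.aemeasurable_fun_sum _ fun j _ =>
        ((hmeas i j).sub_const _).pow_const 2
    obtain ⟨hint, hle⟩ := SPABM.integrable_and_integral_le_of_tail hX
      (fun ω => SPABM.frobSq_nonneg _) hC htail
    have hn2 : (0 : ℝ) ≤ ((n : ℝ) ^ 2)⁻¹ := by positivity
    refine ⟨fun t ht => ?_, hint, ?_⟩
    · obtain ⟨B, hB, hgood⟩ := htail t ht
      -- Subadditivity suffices, so measurability of the exceptional set plays no role.
      have hcompl : 1 ≤ μ.real B + μ.real Bᶜ := by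
        rw [← MeasureTheory.probReal_univ (μ := μ), ← Set.union_compl_self B]
        exact MeasureTheory.measureReal_union_le _ _
      refine le_trans (by linarith) (MeasureTheory.measureReal_mono (s₁ := Bᶜ) fun ω hω => ?_)
      refine (mul_le_mul_of_nonneg_left (hgood ω hω) hn2).trans (le_of_eq ?_)
      ring
    · refine (mul_le_mul_of_nonneg_left hle hn2).trans (le_of_eq ?_)
      ring
  · exact SPABM.exists_penalty_rate_bounds (by rw [SPABM.betaOne]; positivity)
      (by rw [SPABM.betaTwo]; positivity)
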